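/- Let $P$ be a regular right-angled hexagon in the hyperbolic plane $\mathbb H$, with sides indexed cyclically by $\mathbb Z/6\mathbb Z$. For $i\in\mathbb Z/6\mathbb Z$ let $\Delta_i$ be the geodesic line containing the side of index $i$ and let $s_i$ be the reflection in $\Delta_i$. Let $W$ be the group of isometries generated by $s_0,\dots,s_5$, and let $H\subset W$ be the normal subgroup generated by the elements $(s_is_j)^2$, $i,j\in\mathbb Z/6\mathbb Z$ (equivalently, by the $(s_is_{i+2})^2$ and the $(s_is_{i+3})^2$). Put $S_{17}=\mathbb H/H$. A curve of the tessellation of $S_{17}$ is the image in $S_{17}$ of a line $w\Delta_i$ with $w\in W$; a systole of $S_{17}$ is a closed geodesic of minimal length, regarded as an unparametrized curve. Then $W/H\cong(\mathbb Z/2\mathbb Z)^6$; the group $H$ consists of orientation-preserving isometries and acts freely, properly discontinuously and cocompactly on $\mathbb H$, so that $S_{17}$ is a closed oriented hyperbolic surface. The images of the hexagons $wP$, $w\in W$, form a tessellation of $S_{17}$ by $64$ embedded right-angled hexagons, and $S_{17}$ has genus $17$. The systoles of $S_{17}$ are exactly the curves of this tessellation. There are $48$ of them, and their length is $4\,\mathrm{arcosh}\,2$.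 -/

import Mathlib

open scoped UpperHalfPlane MatrixGroups Pointwise

noncomputable section

namespace Hexagon

/-! ### The regular right-angled hexagon and its reflections

`PGL(2, ℝ)` acts faithfully on the upper half-plane `ℍ`, as its full group of isometries (classes of
negative determinant act by `z ↦ (a z̄ + b) / (c z̄ + d)`). -/

/-- The direction, seen from the centre `i` of the hexagon, of the side of index `k`. -/
def theta (k : ZMod 6) : ℝ := (k.val : ℝ) * (Real.pi / 3)

/-- `sinh` of the signed distance from `z` to the line carrying the side of index `k`: negative on the
side of `i`, zero exactly on the line. The three quotients are the hyperboloid coordinates of `z`;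
the apothem of the hexagon has hyperbolic cosine `√2`. -/
def height (k : ZMod 6) (z : ℍ) : ℝ :=
  √2 * (Real.cos (theta k) * ((z.re ^ 2 + z.im ^ 2 - 1) / (2 * z.im))
      + Real.sin (theta k) * (z.re / z.im))
    - (z.re ^ 2 + z.im ^ 2 + 1) / (2 * z.im)

/-- The geodesic line `Δ_k` containing the side of index `k`. -/
def line (k : ZMod 6) : Set ℍ := {z | height k z = 0}

/-- The (closed) regular right-angled hexagon with centre `i`. -/
def hexagon : Set ℍ := {z | ∀ k, height k z ≤ 0}

/-- The side of index `k` of the hexagon. -/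
def side (k : ZMod 6) : Set ℍ := hexagon ∩ line k

/-- The reciprocal of the imaginary part of the vertex common to the sides `k - 1` and `k`. -/
def vertexScale (k : ZMod 6) : ℝ := √3 - √2 * Real.cos (theta k - Real.pi / 6)

lemma vertexScale_pos (k : ZMod 6) : 0 < vertexScale k := by
  have h1 : √2 * Real.cos (theta k - Real.pi / 6) ≤ √2 * 1 :=
    mul_le_mul_of_nonneg_left (Real.cos_le_one _) (Real.sqrt_nonneg _)
  have h2 : √2 < √3 := Real.sqrt_lt_sqrt (by norm_num) (by norm_num)
  unfold vertexScale
  linarith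

/-- The vertex of the hexagon common to the sides of index `k - 1` and `k`. -/
def vertex (k : ZMod 6) : ℍ :=
  ⟨⟨√2 * Real.sin (theta k - Real.pi / 6) / vertexScale k, 1 / vertexScale k⟩,
    one_div_pos.2 (vertexScale_pos k)⟩

/-- The matrix of the reflection in `line k`. -/
def reflMatrix (k : ZMod 6) : Matrix (Fin 2) (Fin 2) ℝ :=
  !![-(√2 * Real.sin (theta k)), √2 * Real.cos (theta k) + 1;
     √2 * Real.cos (theta k) - 1, √2 * Real.sin (theta k)]

lemma det_reflMatrix (k : ZMod 6) : (reflMatrix k).det = -1 := by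
  have h := Real.sin_sq_add_cos_sq (theta k)
  have h2 : √2 ^ 2 = 2 := Real.sq_sqrt (by norm_num)
  rw [reflMatrix, Matrix.det_fin_two_of]
  linear_combination (-√2 ^ 2) * h - h2

/-- The reflection `s_k` in the line `Δ_k`. -/
def refl (k : ZMod 6) : PGL(2, ℝ) :=
  Matrix.ProjGenLinGroup.mk
    (Matrix.GeneralLinearGroup.mkOfDetNeZero (reflMatrix k) (by rw [det_reflMatrix]; norm_num))

/-! The following facts confirm that the hexagon is regular and right-angled. -/

lemma exists_theta_succ (k : ZMod 6) :
    ∃ n : ℤ, theta (k + 1) = theta k + Real.pi / 3 - n * (2 * Real.pi) := by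
  have h : ∀ k : ZMod 6, (k + 1).val = k.val + 1 ∨ ((k + 1).val = 0 ∧ k.val = 5) := by decide
  rcases h k with h | ⟨h, h'⟩
  · exact ⟨0, by simp only [theta, h]; push_cast; ring⟩
  · exact ⟨1, by simp only [theta, h, h']; push_cast; ring⟩

lemma cos_theta_succ (k : ZMod 6) (a : ℝ) :
    Real.cos (theta (k + 1) - a) = Real.cos (theta k + Real.pi / 3 - a) := by
  obtain ⟨n, hn⟩ := exists_theta_succ k
  rw [hn, sub_right_comm, Real.cos_sub_int_mul_two_pi]

lemma sin_theta_succ (k : ZMod 6) (a : ℝ) :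
    Real.sin (theta (k + 1) - a) = Real.sin (theta k + Real.pi / 3 - a) := by
  obtain ⟨n, hn⟩ := exists_theta_succ k
  rw [hn, sub_right_comm, Real.sin_sub_int_mul_two_pi]

/-- `refl k` is the reflection in `line k`: its fixed points are the points of that line. -/
lemma refl_smul_eq_iff (k : ZMod 6) (z : ℍ) : refl k • z = z ↔ z ∈ line k := by
  set g := Matrix.GeneralLinearGroup.mkOfDetNeZero (reflMatrix k)
    (by rw [det_reflMatrix]; norm_num) with hg
  have hdet : ¬ 0 < g.det.val := by
    have : g.det.val = -1 := det_reflMatrix k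
    rw [this]; norm_num
  have hy := z.im_pos
  have h0 : UpperHalfPlane.denom g z ≠ 0 := UpperHalfPlane.denom_ne_zero g z
  have h0' : (starRingEnd ℂ) (UpperHalfPlane.denom g z) ≠ 0 := by simp [h0]
  have e : refl k • z = g • z := UpperHalfPlane.pglMk_smul g z
  rw [e, UpperHalfPlane.ext_iff, UpperHalfPlane.coe_smul, UpperHalfPlane.σ, if_neg hdet]
  simp only [Complex.conjCAE_apply, map_div₀]
  rw [div_eq_iff h0']
  have g00 : g 0 0 = -(√2 * Real.sin (theta k)) := rfl
  have g01 : g 0 1 = √2 * Real.cos (theta k) + 1 := rfl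
  have g10 : g 1 0 = √2 * Real.cos (theta k) - 1 := rfl
  have g11 : g 1 1 = √2 * Real.sin (theta k) := rfl
  simp only [UpperHalfPlane.num, UpperHalfPlane.denom, g00, g01, g10, g11, line,
    Set.mem_ofPred_eq, height, Complex.ext_iff]
  generalize Real.cos (theta k) = c
  generalize Real.sin (theta k) = d
  simp
  field_simp
  constructor
  · rintro ⟨h1, h2⟩
    linarith
  · intro h
    constructor <;> linarith

/-- The lines carrying consecutive sides are perpendicular. -/
lemma refl_mul_refl_sq (k : ZMod 6) : (refl k * refl (k + 1)) ^ 2 = 1 := by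
  have hc := cos_theta_succ k 0
  have hd := sin_theta_succ k 0
  simp only [sub_zero, Real.cos_add, Real.sin_add, Real.cos_pi_div_three,
    Real.sin_pi_div_three] at hc hd
  have h1 := Real.sin_sq_add_cos_sq (theta k)
  have h2 : √2 ^ 2 = 2 := Real.sq_sqrt (by norm_num)
  have h3 : √3 ^ 2 = 3 := Real.sq_sqrt (by norm_num)
  have key : (reflMatrix k * reflMatrix (k + 1)) ^ 2 = -1 := by
    have htr : (reflMatrix k * reflMatrix (k + 1)).trace = 0 := by
      simp only [reflMatrix, hc, hd, Matrix.mul_fin_two, Matrix.trace_fin_two_of]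
      linear_combination √2 ^ 2 * h1 + h2
    have hdt : (reflMatrix k * reflMatrix (k + 1)).det = 1 := by
      rw [Matrix.det_mul, det_reflMatrix, det_reflMatrix]; norm_num
    generalize reflMatrix k * reflMatrix (k + 1) = M at htr hdt
    rw [Matrix.trace_fin_two] at htr
    rw [Matrix.det_fin_two] at hdt
    ext i j
    fin_cases i <;> fin_cases j <;> simp [sq, Matrix.mul_apply, Fin.sum_univ_two]
    · linear_combination M 0 0 * htr - hdt
    · linear_combination M 0 1 * htr
    · linear_combination M 1 0 * htr
    · linear_combination M 1 1 * htr - hdt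
  rw [refl, refl, ← map_mul, ← map_pow,
    ← Matrix.ProjGenLinGroup.mk_scalar (n := Fin 2) (R := ℝ) (-1)]
  congr 1
  ext i j
  have := congrFun (congrFun key i) j
  rw [← Matrix.diagonal_one, Matrix.diagonal_neg] at this
  simpa [Matrix.GeneralLinearGroup.mkOfDetNeZero] using this

/-- All sides have length `arcosh 2`. -/
lemma dist_vertex (k : ZMod 6) : dist (vertex k) (vertex (k + 1)) = Real.arcosh 2 := by
  have h1 := vertexScale_pos k
  have h2 := vertexScale_pos (k + 1)
  have hc := cos_theta_succ k (Real.pi / 6)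
  have hd := sin_theta_succ k (Real.pi / 6)
  rw [add_sub_right_comm, Real.cos_add, Real.cos_pi_div_three, Real.sin_pi_div_three] at hc
  rw [add_sub_right_comm, Real.sin_add, Real.cos_pi_div_three, Real.sin_pi_div_three] at hd
  rw [← Real.arcosh_cosh (dist_nonneg (x := vertex k) (y := vertex (k + 1))),
    UpperHalfPlane.cosh_dist']
  congr 1
  have s1 := Real.sin_sq_add_cos_sq (theta k - Real.pi / 6)
  have q2 : √2 ^ 2 = 2 := Real.sq_sqrt (by norm_num)
  have q3 : √3 ^ 2 = 3 := Real.sq_sqrt (by norm_num)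
  have e1 : vertexScale k = √3 - √2 * Real.cos (theta k - Real.pi / 6) := rfl
  have e2 : vertexScale (k + 1) = √3 - √2 * Real.cos (theta (k + 1) - Real.pi / 6) := rfl
  have s2 := Real.sin_sq_add_cos_sq (theta (k + 1) - Real.pi / 6)
  change ((√2 * Real.sin (theta k - Real.pi / 6) / vertexScale k
    - √2 * Real.sin (theta (k + 1) - Real.pi / 6) / vertexScale (k + 1)) ^ 2
    + (1 / vertexScale k) ^ 2 + (1 / vertexScale (k + 1)) ^ 2)
    / (2 * (1 / vertexScale k) * (1 / vertexScale (k + 1))) = 2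
  generalize vertexScale k = u at *
  generalize vertexScale (k + 1) = v at *
  have hin : Real.cos (theta k - Real.pi / 6) * Real.cos (theta (k + 1) - Real.pi / 6)
      + Real.sin (theta k - Real.pi / 6) * Real.sin (theta (k + 1) - Real.pi / 6) = 1 / 2 := by
    rw [hc, hd]; linear_combination (1 / 2) * s1
  generalize Real.cos (theta k - Real.pi / 6) = a at *
  generalize Real.sin (theta k - Real.pi / 6) = b at *
  generalize Real.cos (theta (k + 1) - Real.pi / 6) = a' at *
  generalize Real.sin (theta (k + 1) - Real.pi / 6) = b' at *
  field_simp
  have t1 : √2 ^ 2 * b ^ 2 + 1 = u * (√3 + √2 * a) := by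
    rw [e1]; linear_combination √2 ^ 2 * s1 + q2 - q3
  have t2 : √2 ^ 2 * b' ^ 2 + 1 = v * (√3 + √2 * a') := by
    rw [e2]; linear_combination √2 ^ 2 * s2 + q2 - q3
  have t3 : (√3 + √2 * a) * v + (√3 + √2 * a') * u - 2 * √2 ^ 2 * b * b' = 4 := by
    rw [e1, e2]; linear_combination (-2 * √2 ^ 2) * hin + 2 * q3 - q2
  linear_combination v ^ 2 * t1 + u ^ 2 * t2 + u * v * t3

lemma height_vertex (j k : ZMod 6) :
    height j (vertex k) = 2 * Real.cos (theta j - (theta k - Real.pi / 6)) - √3 := by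
  have h1 := vertexScale_pos k
  have s1 := Real.sin_sq_add_cos_sq (theta k - Real.pi / 6)
  have q2 : √2 ^ 2 = 2 := Real.sq_sqrt (by norm_num)
  have q3 : √3 ^ 2 = 3 := Real.sq_sqrt (by norm_num)
  have e1 : vertexScale k = √3 - √2 * Real.cos (theta k - Real.pi / 6) := rfl
  have hre : (vertex k).re = √2 * Real.sin (theta k - Real.pi / 6) / vertexScale k := rfl
  have him : (vertex k).im = 1 / vertexScale k := rfl
  rw [height, hre, him, Real.cos_sub]
  generalize vertexScale k = u at *
  generalize Real.cos (theta k - Real.pi / 6) = a at *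
  generalize Real.sin (theta k - Real.pi / 6) = b at *
  generalize Real.cos (theta j) = c at *
  generalize Real.sin (theta j) = d at *
  have t1 : √2 ^ 2 * b ^ 2 + 1 = u * (√3 + √2 * a) := by
    rw [e1]; linear_combination √2 ^ 2 * s1 + q2 - q3
  have t2 : √2 ^ 2 * b ^ 2 + 1 - u ^ 2 = u * (2 * √2 * a) := by
    rw [t1, e1]; ring
  have t3 : √2 ^ 2 * b ^ 2 + 1 + u ^ 2 = u * (2 * √3) := by
    rw [t1, e1]; ring
  field_simp
  linear_combination √2 * c * t2 - t3 + 2 * u * (c * a + b * d) * q2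

/-- The points `vertex k` and `vertex (k + 1)` are the end points of the side of index `k`. -/
lemma vertex_mem_hexagon (k : ZMod 6) :
    vertex k ∈ hexagon ∧ vertex k ∈ line k ∧ vertex (k + 1) ∈ line k := by
  have q3 : √3 ^ 2 = 3 := Real.sq_sqrt (by norm_num)
  have q0 : 0 ≤ √3 := Real.sqrt_nonneg _
  refine ⟨fun j => ?_, ?_, ?_⟩
  · rw [height_vertex]
    have h : Real.cos (3 * (theta j - (theta k - Real.pi / 6))) = 0 := by
      rw [Real.cos_eq_zero_iff]
      refine ⟨(j.val : ℤ) - k.val, ?_⟩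
      simp only [theta]
      push_cast
      ring
    rw [Real.cos_three_mul] at h
    generalize Real.cos (theta j - (theta k - Real.pi / 6)) = c at *
    by_contra hc
    have : 0 < c := by linarith
    have hp : 0 < c * (2 * c - √3) * (2 * c + √3) :=
      mul_pos (mul_pos this (by linarith)) (by linarith)
    nlinarith
  · change height k (vertex k) = 0
    rw [height_vertex, sub_sub_cancel, Real.cos_pi_div_six]; ring
  · change height k (vertex (k + 1)) = 0
    rw [height_vertex, ← Real.cos_neg]
    have h := cos_theta_succ k (Real.pi / 6 + theta k)
    rw [show -(theta k - (theta (k + 1) - Real.pi / 6)) = theta (k + 1) - (Real.pi / 6 + theta k)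
      by ring, h, show theta k + Real.pi / 3 - (Real.pi / 6 + theta k) = Real.pi / 6 by ring,
      Real.cos_pi_div_six]
    ring

/-- The Coxeter group `W` generated by the six reflections. -/
def W : Subgroup PGL(2, ℝ) := Subgroup.closure (Set.range refl)

/-- The reflection `s_k`, as an element of `W`. -/
def s (k : ZMod 6) : W := ⟨refl k, Subgroup.subset_closure ⟨k, rfl⟩⟩

/-- The normal subgroup of `W` generated by the elements `(s_i s_j)²`. -/
abbrev H : Subgroup W := Subgroup.normalClosure {r | ∃ i j : ZMod 6, r = (s i * s j) ^ 2}

/-- `H` as a group of isometries of `ℍ`. -/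
def H17 : Subgroup PGL(2, ℝ) := H.map W.subtype

/-! ### Quotient surfaces -/

/-- The quotient `ℍ / Γ`. -/
abbrev Surface (Γ : Subgroup PGL(2, ℝ)) : Type := MulAction.orbitRel.Quotient Γ ℍ

/-- The projection `ℍ → ℍ / Γ`. -/
def proj (Γ : Subgroup PGL(2, ℝ)) (z : ℍ) : Surface Γ := Quotient.mk _ z

/-- `ℍ / Γ` is a closed oriented hyperbolic surface with universal covering `ℍ → ℍ / Γ`: the group
`Γ` consists of orientation-preserving isometries and acts freely, properly discontinuously and
cocompactly. (Connectedness is automatic.) -/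
structure IsClosedSurfaceGroup (Γ : Subgroup PGL(2, ℝ)) : Prop where
  orientation : ∀ g ∈ Γ, ∃ m : SL(2, ℝ), ∀ z : ℍ, g • z = m • z
  free : ∀ g ∈ Γ, ∀ z : ℍ, g • z = z → g = 1
  discontinuous : ProperlyDiscontinuousSMul Γ ℍ
  compact : CompactSpace (Surface Γ)

/-- `c : ℝ → ℍ / Γ` is a closed geodesic of length `ℓ`, parametrized by arc length: it is the
projection of a geodesic line of `ℍ` (an isometric embedding of `ℝ`) and is `ℓ`-periodic. -/
def IsClosedGeodesic (Γ : Subgroup PGL(2, ℝ)) (c : ℝ → Surface Γ) (ℓ : ℝ) : Prop :=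
  0 < ℓ ∧ Function.Periodic c ℓ ∧ ∃ γ : ℝ → ℍ, Isometry γ ∧ c = proj Γ ∘ γ

/-- The systoles of `ℍ / Γ`: the closed geodesics of minimal length, as unparametrized curves. -/
def systoles (Γ : Subgroup PGL(2, ℝ)) : Set (Set (Surface Γ)) :=
  {C | ∃ c ℓ, IsClosedGeodesic Γ c ℓ ∧
    (∀ c' ℓ', IsClosedGeodesic Γ c' ℓ' → ℓ ≤ ℓ') ∧ C = Set.range c}

/-! ### The tessellation of `ℍ / Γ` by the images of the hexagons `w • hexagon`, `w ∈ W` -/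

/-- The tiles of the tessellation. -/
def tiles (Γ : Subgroup PGL(2, ℝ)) : Set (Set (Surface Γ)) :=
  {T | ∃ w ∈ W, T = proj Γ '' (w • hexagon)}

/-- The edges of the tessellation. -/
def edges (Γ : Subgroup PGL(2, ℝ)) : Set (Set (Surface Γ)) :=
  {E | ∃ w ∈ W, ∃ k, E = proj Γ '' (w • side k)}

/-- The vertices of the tessellation. -/
def vertices (Γ : Subgroup PGL(2, ℝ)) : Set (Surface Γ) :=
  {p | ∃ w ∈ W, ∃ k, p = proj Γ (w • vertex k)}

/-- The curves of the tessellation, which make up its 1-skeleton: the images of the lines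
`w • Δ_k`. -/
def curves (Γ : Subgroup PGL(2, ℝ)) : Set (Set (Surface Γ)) :=
  {C | ∃ w ∈ W, ∃ k, C = proj Γ '' (w • line k)}

/-- `ℍ / Γ` is tessellated by the images of the hexagons: each hexagon is embedded in the surface,
the tiles cover the surface, and distinct tiles meet only along edges. -/
structure IsTessellated (Γ : Subgroup PGL(2, ℝ)) : Prop where
  embedded : ∀ w ∈ W, Set.InjOn (proj Γ) (w • hexagon)
  cover : ⋃₀ tiles Γ = Set.univ
  inter : ∀ T ∈ tiles Γ, ∀ T' ∈ tiles Γ, T ≠ T' → T ∩ T' ⊆ ⋃₀ edges Γ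

/-- The closed oriented surface `ℍ / Γ` has genus `g`: the Euler characteristic, computed with the
tessellation, is `2 - 2 g`. -/
def HasGenus (Γ : Subgroup PGL(2, ℝ)) (g : ℕ) : Prop :=
  (vertices Γ).Finite ∧ (edges Γ).Finite ∧ (tiles Γ).Finite ∧
    ((vertices Γ).ncard : ℤ) - (edges Γ).ncard + (tiles Γ).ncard = 2 - 2 * g

end Hexagon

end

open scoped UpperHalfPlane MatrixGroups Pointwise

noncomputable section

namespace Hexagon

/-! ### The lattice spanned by the normal vectors of the sides -/

/-! Everything is arithmetic in the lattice `ℤ³` with the form `x² + y² - 3z²`, of signature (2,1).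
The unit normals of the six sides lie in it, with pairwise products 0 (adjacent sides), -2 and -3,
so `W` acts on it by integral isometries, and `ℍ` is one sheet of the hyperboloid of vectors of norm
-1 (`coord`).

The group `W / H` is abelian and generated by six involutions, so it has at most 64 elements. It has
no fewer, because `H` acts trivially modulo a suitable sublattice while the nontrivial products of
distinct reflections, taken in order, do not (`H_le_congruenceSubgroup`,
`eq_zero_of_reflect_sub_mem`). This gives the class `cls w` in `(ℤ/2ℤ)⁶`, with kernel `H`.

The hexagon is a strict fundamental domain for `W` (`exists_smul_mem_hexagon`,
`smul_eq_and_cls_eq_zero`). Two facts make this work: a line orthogonal to a lattice vector of norm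
1 meets the hexagon only if it carries a side (`eq_root_of_bil_eq_zero`), and `W` preserves the
index of a side, since it acts on the six normals trivially modulo 4 up to sign. A cell of the
quotient is then determined by its type and by the class of `w` away from the reflections preserving
it, which yields 64 tiles, 192 edges, 96 vertices and 48 curves, hence Euler characteristic -32.

For lengths, real 2×2 matrices are the Clifford algebra of the form, and every element of `H` is a
matrix `a + 4√3 v` with `a`, `v` integral and `a² - 48 N(v) = 1`, where `N(v) = bil v v`
(`H_le_principalSubgroup`). It moves `z` by a distance `d` with `cosh d = 1 + 96 (N(v) + ⟨v, z⟩²)`.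
As the form is anisotropic over `ℤ`, a nontrivial element has `N(v) ≥ 1`, so `cosh d ≥ 97 = cosh (4
arcosh 2)`; in particular the action is free. Equality means that `N(v) = 1` and `z` lies on the
line orthogonal to `v`, which is therefore a translate of some `Δ_k` (`range_mem_curves`).
Conversely `(s_{k+1} s_{k-1})²` belongs to `H` and translates along `Δ_k` by exactly this length
(`isClosedGeodesic_curve`). -/

/-- The quadratic form `x² + y² - 3 z²` (in polarized form). It is the Lorentz form in the basis
given by the normal vectors `e₀`, `e₁` of the sides `0` and `1` and the vector `e₂ + 2 e₀`. -/
def bil {R : Type*} [CommRing R] (p q : R × R × R) : R :=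
  p.1 * q.1 + p.2.1 * q.2.1 - 3 * (p.2.2 * q.2.2)

/-- The cross product attached to `bil`, scaled by `√3`. -/
def wedge {R : Type*} [CommRing R] (p q : R × R × R) : R × R × R :=
  (3 * (p.2.2 * q.2.1 - p.2.1 * q.2.2), 3 * (p.1 * q.2.2 - p.2.2 * q.1),
    p.1 * q.2.1 - p.2.1 * q.1)

/-- The reflection along a vector `e` with `bil e e = 1`. -/
def reflect {R : Type*} [CommRing R] (e p : R × R × R) : R × R × R :=
  p - (2 * bil p e) • e

/-- The outer normal vector of the side of index `k`. -/
def root : ZMod 6 → ℤ × ℤ × ℤ :=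
  ![(1, 0, 0), (0, 1, 0), (-2, 0, 1), (-3, -2, 2), (-2, -3, 2), (0, -2, 1)]

/-- The vector of the centre of the hexagon. -/
def center : ℤ × ℤ × ℤ := (-1, -1, 1)

/-- The embedding of the lattice into the Lorentz space. -/
def toReal (v : ℤ × ℤ × ℤ) : ℝ × ℝ × ℝ := (v.1, v.2.1, v.2.2)

/-- The point of the hyperboloid corresponding to `z`. -/
def coord (z : ℍ) : ℝ × ℝ × ℝ :=
  (height 0 z, height 1 z, -(height 2 z + 2 * height 0 z) / 3)

section algebra
variable {R : Type*} [CommRing R]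

lemma bil_comm (p q : R × R × R) : bil p q = bil q p := by simp only [bil]; ring

lemma bil_add_left (p q r : R × R × R) : bil (p + q) r = bil p r + bil q r := by
  simp only [bil, Prod.fst_add, Prod.snd_add]; ring

lemma bil_add_right (p q r : R × R × R) : bil p (q + r) = bil p q + bil p r := by
  simp only [bil, Prod.fst_add, Prod.snd_add]; ring

lemma bil_sub_left (p q r : R × R × R) : bil (p - q) r = bil p r - bil q r := by
  simp only [bil, Prod.fst_sub, Prod.snd_sub]; ring

lemma bil_sub_right (p q r : R × R × R) : bil p (q - r) = bil p q - bil p r := by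
  simp only [bil, Prod.fst_sub, Prod.snd_sub]; ring

lemma bil_smul_left (a : R) (p q : R × R × R) : bil (a • p) q = a * bil p q := by
  simp only [bil, Prod.smul_fst, Prod.smul_snd, smul_eq_mul]; ring

lemma bil_smul_right (a : R) (p q : R × R × R) : bil p (a • q) = a * bil p q := by
  simp only [bil, Prod.smul_fst, Prod.smul_snd, smul_eq_mul]; ring

lemma bil_neg_left (p q : R × R × R) : bil (-p) q = -bil p q := by
  simp only [bil, Prod.fst_neg, Prod.snd_neg]; ring

lemma bil_neg_right (p q : R × R × R) : bil p (-q) = -bil p q := by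
  simp only [bil, Prod.fst_neg, Prod.snd_neg]; ring

lemma bil_reflect_left (e p q : R × R × R) : bil (reflect e p) q = bil p (reflect e q) := by
  simp only [reflect, bil_sub_left, bil_sub_right, bil_smul_left, bil_smul_right, bil_comm q e]
  ring

lemma reflect_reflect {e : R × R × R} (he : bil e e = 1) (p : R × R × R) :
    reflect e (reflect e p) = p := by
  have h : bil (reflect e p) e = -bil p e := by
    rw [reflect, bil_sub_left, bil_smul_left, he]; ring
  rw [reflect, h, reflect]
  module

lemma bil_reflect_reflect {e : R × R × R} (he : bil e e = 1) (p q : R × R × R) :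
    bil (reflect e p) (reflect e q) = bil p q := by
  rw [bil_reflect_left, reflect_reflect he]

end algebra

lemma bil_toReal (v w : ℤ × ℤ × ℤ) : bil (toReal v) (toReal w) = (bil v w : ℤ) := by
  simp [bil, toReal]

lemma toReal_neg (v : ℤ × ℤ × ℤ) : toReal (-v) = -toReal v := by
  simp [toReal]

lemma toReal_reflect (v w : ℤ × ℤ × ℤ) :
    toReal (reflect v w) = reflect (toReal v) (toReal w) := by
  rw [reflect, reflect, bil_toReal]
  simp [toReal]

lemma toReal_injective : Function.Injective toReal := by
  rintro ⟨a, b, c⟩ ⟨a', b', c'⟩ h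
  simpa [toReal] using h

lemma bil_root_self : ∀ k, bil (root k) (root k) = 1 := by decide

lemma bil_center_root : ∀ k, bil center (root k) = -1 := by decide

/-! ### Hyperboloid coordinates -/

lemma forall_zmod_six {p : ZMod 6 → Prop} (h0 : p 0) (h1 : p 1) (h2 : p 2) (h3 : p 3) (h4 : p 4)
    (h5 : p 5) (k : ZMod 6) : p k := by
  change Fin 6 at k
  fin_cases k <;> assumption

/-- In an orthonormal Lorentz basis the normal of side `k` is `(√2 cos θ, √2 sin θ, 1)`; the three
equations express this vector through its integral coordinates. -/
lemma cos_sin_theta : ∀ k : ZMod 6,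
    √2 * Real.cos (theta k) = √2 * ((root k).1 + (root k).2.1 / 2 + 3 * (root k).2.2 / 2) ∧
    √2 * Real.sin (theta k) = √2 * √3 / 2 * ((root k).2.1 + (root k).2.2) ∧
    (root k).1 + (root k).2.1 + 3 * (root k).2.2 = 1 := by
  have c2 : Real.cos (2 * (Real.pi / 3)) = -1 / 2 := by
    rw [show 2 * (Real.pi / 3) = Real.pi - Real.pi / 3 by ring, Real.cos_pi_sub,
      Real.cos_pi_div_three]; norm_num
  have s2 : Real.sin (2 * (Real.pi / 3)) = √3 / 2 := by
    rw [show 2 * (Real.pi / 3) = Real.pi - Real.pi / 3 by ring, Real.sin_pi_sub,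
      Real.sin_pi_div_three]
  have c4 : Real.cos (4 * (Real.pi / 3)) = -1 / 2 := by
    rw [show 4 * (Real.pi / 3) = Real.pi / 3 + Real.pi by ring, Real.cos_add_pi,
      Real.cos_pi_div_three]; norm_num
  have s4 : Real.sin (4 * (Real.pi / 3)) = -(√3 / 2) := by
    rw [show 4 * (Real.pi / 3) = Real.pi / 3 + Real.pi by ring, Real.sin_add_pi,
      Real.sin_pi_div_three]
  have c5 : Real.cos (5 * (Real.pi / 3)) = 1 / 2 := by
    rw [show 5 * (Real.pi / 3) = 2 * Real.pi - Real.pi / 3 by ring, Real.cos_two_pi_sub,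
      Real.cos_pi_div_three]
  have s5 : Real.sin (5 * (Real.pi / 3)) = -(√3 / 2) := by
    rw [show 5 * (Real.pi / 3) = 2 * Real.pi - Real.pi / 3 by ring, Real.sin_two_pi_sub,
      Real.sin_pi_div_three]
  have t0 : theta 0 = 0 := by simp [theta]
  have t1 : theta 1 = Real.pi / 3 := by
    rw [theta, show (1 : ZMod 6).val = 1 from rfl]; simp
  have t2 : theta 2 = 2 * (Real.pi / 3) := by
    rw [theta, show (2 : ZMod 6).val = 2 from rfl]; simp
  have t3 : theta 3 = Real.pi := by
    rw [theta, show (3 : ZMod 6).val = 3 from rfl]; push_cast; ring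
  have t4 : theta 4 = 4 * (Real.pi / 3) := by
    rw [theta, show (4 : ZMod 6).val = 4 from rfl]; simp
  have t5 : theta 5 = 5 * (Real.pi / 3) := by
    rw [theta, show (5 : ZMod 6).val = 5 from rfl]; simp
  refine forall_zmod_six ?_ ?_ ?_ ?_ ?_ ?_
  · rw [t0, show root 0 = (1, 0, 0) from rfl]; simp
  · rw [t1, show root 1 = (0, 1, 0) from rfl]; norm_num; ring
  · rw [t2, c2, s2, show root 2 = (-2, 0, 1) from rfl]
    refine ⟨?_, ?_, ?_⟩ <;> push_cast <;> ring
  · rw [t3, show root 3 = (-3, -2, 2) from rfl]; norm_num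
  · rw [t4, c4, s4, show root 4 = (-2, -3, 2) from rfl]
    refine ⟨?_, ?_, ?_⟩ <;> push_cast <;> ring
  · rw [t5, c5, s5, show root 5 = (0, -2, 1) from rfl]
    refine ⟨?_, ?_, ?_⟩ <;> push_cast <;> ring

lemma sqrt_two_sq : √2 ^ 2 = (2 : ℝ) := Real.sq_sqrt (by norm_num)

lemma sqrt_three_sq : √3 ^ 2 = (3 : ℝ) := Real.sq_sqrt (by norm_num)

/-- The height in terms of the integral coordinates of the root. -/
lemma height_eq_root (k : ZMod 6) (z : ℍ) : height k z =
    √2 * ((root k).1 + (root k).2.1 / 2 + 3 * (root k).2.2 / 2)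
        * ((z.re ^ 2 + z.im ^ 2 - 1) / (2 * z.im))
      + √2 * √3 / 2 * ((root k).2.1 + (root k).2.2) * (z.re / z.im)
      - ((root k).1 + (root k).2.1 + 3 * (root k).2.2)
        * ((z.re ^ 2 + z.im ^ 2 + 1) / (2 * z.im)) := by
  obtain ⟨h1, h2, h3⟩ := cos_sin_theta k
  have h3' : ((root k).1 + (root k).2.1 + 3 * (root k).2.2 : ℝ) = 1 := by exact_mod_cast h3
  rw [height, h3', ← h1, ← h2]
  ring

lemma coord_eq (z : ℍ) : coord z =
    (√2 * ((z.re ^ 2 + z.im ^ 2 - 1) / (2 * z.im)) - (z.re ^ 2 + z.im ^ 2 + 1) / (2 * z.im),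
     √2 / 2 * ((z.re ^ 2 + z.im ^ 2 - 1) / (2 * z.im)) + √2 * √3 / 2 * (z.re / z.im)
      - (z.re ^ 2 + z.im ^ 2 + 1) / (2 * z.im),
     (-(3 * √2 / 2 * ((z.re ^ 2 + z.im ^ 2 - 1) / (2 * z.im))) - √2 * √3 / 2 * (z.re / z.im)
      + 3 * ((z.re ^ 2 + z.im ^ 2 + 1) / (2 * z.im))) / 3) := by
  rw [coord, height_eq_root, height_eq_root, height_eq_root, show root 0 = (1, 0, 0) from rfl,
    show root 1 = (0, 1, 0) from rfl, show root 2 = (-2, 0, 1) from rfl]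
  ext <;> push_cast <;> ring

lemma height_eq_bil (k : ZMod 6) (z : ℍ) : height k z = bil (toReal (root k)) (coord z) := by
  rw [height_eq_root, coord_eq]
  simp only [bil, toReal]
  ring

lemma cosh_dist_eq_bil (z w : ℍ) : Real.cosh (dist z w) = -bil (coord z) (coord w) := by
  have hz := z.im_pos
  have hw := w.im_pos
  rw [UpperHalfPlane.cosh_dist', coord_eq, coord_eq]
  simp only [bil]
  have e1 : ((z.re - w.re) ^ 2 + z.im ^ 2 + w.im ^ 2) / (2 * z.im * w.im) =
      (z.re ^ 2 + z.im ^ 2 + 1) / (2 * z.im) * ((w.re ^ 2 + w.im ^ 2 + 1) / (2 * w.im))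
      - (z.re ^ 2 + z.im ^ 2 - 1) / (2 * z.im) * ((w.re ^ 2 + w.im ^ 2 - 1) / (2 * w.im))
      - (z.re / z.im) * (w.re / w.im) := by
    field_simp
    ring
  rw [e1]
  generalize (z.re ^ 2 + z.im ^ 2 + 1) / (2 * z.im) = t
  generalize (z.re ^ 2 + z.im ^ 2 - 1) / (2 * z.im) = x
  generalize z.re / z.im = y
  generalize (w.re ^ 2 + w.im ^ 2 + 1) / (2 * w.im) = t'
  generalize (w.re ^ 2 + w.im ^ 2 - 1) / (2 * w.im) = x'
  generalize w.re / w.im = y'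
  linear_combination (1 / 2 * x * x' + √3 ^ 2 / 6 * y * y') * sqrt_two_sq
    + 1 / 3 * y * y' * sqrt_three_sq

lemma bil_coord_self (z : ℍ) : bil (coord z) (coord z) = -1 := by
  have h := cosh_dist_eq_bil z z
  rw [dist_self, Real.cosh_zero] at h
  linarith

lemma bil_coord_le (z w : ℍ) : bil (coord z) (coord w) ≤ -1 := by
  have h := Real.one_le_cosh (dist z w)
  rw [cosh_dist_eq_bil] at h
  linarith

lemma coord_injective : Function.Injective coord := fun z w h => by
  have h1 := cosh_dist_eq_bil z w
  rw [h, bil_coord_self, neg_neg] at h1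
  exact dist_eq_zero.1 (by_contra fun h0 => (Real.one_lt_cosh.2 h0).ne' h1)

lemma coord_I : coord UpperHalfPlane.I = toReal center := by
  rw [coord_eq]
  simp [toReal, center]

lemma exists_coord_eq {p : ℝ × ℝ × ℝ} (hp : bil p p = -1) (hc : bil (toReal center) p < 0) :
    ∃ z, coord z = p := by
  obtain ⟨a, b, c⟩ := p
  have q2 := sqrt_two_sq
  have q3 := sqrt_three_sq
  simp only [bil, toReal, center] at hp hc
  push_cast at hc
  set t : ℝ := a + b + 3 * c with ht
  set x : ℝ := √2 * (a + b / 2 + 3 * c / 2) with hx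
  set y : ℝ := √2 * √3 / 2 * (b + c) with hy
  have hxy : t ^ 2 = x ^ 2 + y ^ 2 + 1 := by
    rw [ht, hx, hy]
    linear_combination (-(a + b / 2 + 3 * c / 2) ^ 2 - √3 ^ 2 / 4 * (b + c) ^ 2) * q2
      - (b + c) ^ 2 / 2 * q3 - hp
  have ht0 : 0 < t := by rw [ht]; linarith
  have hd : 0 < t - x := by nlinarith [sq_nonneg y]
  -- In the orthonormal coordinates `x`, `y`, `t` of a point of `ℍ`, `t - x` is the inverse of the
  -- imaginary part and `y` is the quotient of real by imaginary part.
  refine ⟨⟨⟨y / (t - x), 1 / (t - x)⟩, one_div_pos.2 hd⟩, ?_⟩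
  rw [coord_eq]
  set z : ℍ := ⟨⟨y / (t - x), 1 / (t - x)⟩, one_div_pos.2 hd⟩ with hz
  have hre : z.re = y / (t - x) := rfl
  have him : z.im = 1 / (t - x) := rfl
  have e1 : (z.re ^ 2 + z.im ^ 2 - 1) / (2 * z.im) = x := by
    rw [hre, him]; field_simp; linear_combination -hxy
  have e2 : (z.re ^ 2 + z.im ^ 2 + 1) / (2 * z.im) = t := by
    rw [hre, him]; field_simp; linear_combination -hxy
  have e3 : z.re / z.im = y := by
    rw [hre, him]; field_simp
  rw [e1, e2, e3]
  ext
  · simp only [ht, hx]; linear_combination (a + b / 2 + 3 * c / 2) * q2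
  · simp only [ht, hx, hy]
    linear_combination ((a + b / 2 + 3 * c / 2) / 2 + √3 ^ 2 / 4 * (b + c)) * q2 + (b + c) / 2 * q3
  · simp only [ht, hx, hy]
    linear_combination (-(a + b / 2 + 3 * c / 2) / 2 - √3 ^ 2 / 12 * (b + c)) * q2 - (b + c) / 6 * q3

/-! ### Matrices -/

/-- The real `2 × 2` matrices as the Clifford algebra of `bil`: the matrix with scalar part `a` and
vector part `p`. -/
def mat (a : ℝ) (p : ℝ × ℝ × ℝ) : Matrix (Fin 2) (Fin 2) ℝ :=
  !![a - √2 * √3 / 2 * (p.2.1 + p.2.2),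
      √2 * (p.1 + p.2.1 / 2 + 3 * p.2.2 / 2) + (p.1 + p.2.1 + 3 * p.2.2);
     √2 * (p.1 + p.2.1 / 2 + 3 * p.2.2 / 2) - (p.1 + p.2.1 + 3 * p.2.2),
      a + √2 * √3 / 2 * (p.2.1 + p.2.2)]

lemma det_mat (a : ℝ) (p : ℝ × ℝ × ℝ) : (mat a p).det = a ^ 2 - bil p p := by
  rw [mat, Matrix.det_fin_two_of, bil]
  linear_combination (-(p.1 + p.2.1 / 2 + 3 * p.2.2 / 2) ^ 2
    - √3 ^ 2 / 4 * (p.2.1 + p.2.2) ^ 2) * sqrt_two_sq - (p.2.1 + p.2.2) ^ 2 / 2 * sqrt_three_sq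

lemma mat_mul_mat (a b : ℝ) (p q : ℝ × ℝ × ℝ) :
    mat a p * mat b q = mat (a * b + bil p q) (a • q + b • p + (√3 / 3) • wedge p q) := by
  have q2 := sqrt_two_sq
  have q3 := sqrt_three_sq
  obtain ⟨x, y, z⟩ := p
  obtain ⟨x', y', z'⟩ := q
  rw [mat, mat, mat, Matrix.mul_fin_two]
  simp only [bil, wedge, Prod.smul_mk, Prod.mk_add_mk, smul_eq_mul]
  ext i j
  fin_cases i <;> fin_cases j <;>
    simp only [Matrix.of_apply, Matrix.cons_val', Matrix.cons_val_zero, Matrix.cons_val_one,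
      Fin.zero_eta, Fin.mk_one, Fin.isValue, Matrix.cons_val_fin_one]
  all_goals
    ring_nf
    simp only [q2, q3]
    ring

/-- The coordinates of `g • z`, up to linear changes, for a matrix `g` of determinant `±1`. -/
lemma re_div_im_smul (g : GL (Fin 2) ℝ) (hg : |g.det.val| = 1) (z : ℍ) :
    (g • z).re / (g • z).im = ((g 0 0 * z.re + g 0 1) * (g 1 0 * z.re + g 1 1)
      + g 0 0 * g 1 0 * z.im ^ 2) / z.im ∧
    ((g • z).re ^ 2 + (g • z).im ^ 2) / (g • z).im =
      ((g 0 0 * z.re + g 0 1) ^ 2 + (g 0 0 * z.im) ^ 2) / z.im ∧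
    1 / (g • z).im = ((g 1 0 * z.re + g 1 1) ^ 2 + (g 1 0 * z.im) ^ 2) / z.im := by
  have hy := z.im_pos
  have hd := UpperHalfPlane.normSq_denom_pos g z.im_ne_zero
  have him := UpperHalfPlane.im_smul_eq_div_normSq g z
  have hre := UpperHalfPlane.re_smul g z
  have hn : (g • z).re ^ 2 + (g • z).im ^ 2 =
      Complex.normSq (UpperHalfPlane.num g z) / Complex.normSq (UpperHalfPlane.denom g z) := by
    rw [hre, UpperHalfPlane.im_smul, sq_abs, ← Complex.normSq_div, Complex.normSq_apply]; ring
  rw [hg, one_mul] at him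
  rw [hn, him]
  rw [hre, Complex.div_re]
  have e1 : Complex.normSq (UpperHalfPlane.denom g z) =
      (g 1 0 * z.re + g 1 1) ^ 2 + (g 1 0 * z.im) ^ 2 := by
    simp [UpperHalfPlane.denom, Complex.normSq_apply]; ring
  have e2 : Complex.normSq (UpperHalfPlane.num g z) =
      (g 0 0 * z.re + g 0 1) ^ 2 + (g 0 0 * z.im) ^ 2 := by
    simp [UpperHalfPlane.num, Complex.normSq_apply]; ring
  have e3 : (UpperHalfPlane.num g z).re * (UpperHalfPlane.denom g z).re
     + (UpperHalfPlane.num g z).im * (UpperHalfPlane.denom g z).im =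
      (g 0 0 * z.re + g 0 1) * (g 1 0 * z.re + g 1 1) + g 0 0 * g 1 0 * z.im ^ 2 := by
    simp [UpperHalfPlane.num, UpperHalfPlane.denom]; ring
  rw [← e1, ← e2, ← e3]
  refine ⟨?_, ?_, ?_⟩ <;> field_simp

lemma reflMatrix_eq_mat (k : ZMod 6) : reflMatrix k = mat 0 (toReal (root k)) := by
  obtain ⟨h1, h2, h3⟩ := cos_sin_theta k
  have h3' : ((root k).1 + (root k).2.1 + 3 * (root k).2.2 : ℝ) = 1 := by exact_mod_cast h3
  rw [reflMatrix, mat, h1, h2]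
  simp only [toReal, h3', zero_sub, zero_add]

/-- A Clifford vector of norm 1 has determinant -1, hence acts antiholomorphically, and on the
hyperboloid it is the reflection along itself. The check is done in orthonormal coordinates `X`,
`Y`, `T` of `p`, where `hn` reads `X² + Y² - T² = 1`. -/
lemma coord_smul_of_coe_eq_mat_zero {g : GL (Fin 2) ℝ} {p : ℝ × ℝ × ℝ}
    (hg : (g : Matrix _ _ ℝ) = mat 0 p)
    (hp : bil p p = 1) (z : ℍ) : coord (g • z) = reflect p (coord z) := by
  have hdet : |g.det.val| = 1 := by
    rw [Matrix.GeneralLinearGroup.val_det_apply, hg, det_mat, hp]; norm_num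
  obtain ⟨h1, h2, h3⟩ := re_div_im_smul g hdet z
  have e1 : ((g • z).re ^ 2 + (g • z).im ^ 2 - 1) / (2 * (g • z).im) =
    (((g • z).re ^ 2 + (g • z).im ^ 2) / (g • z).im - 1 / (g • z).im) / 2 := by
      have := (g • z).im_pos
      field_simp
  have e2 : ((g • z).re ^ 2 + (g • z).im ^ 2 + 1) / (2 * (g • z).im) =
    (((g • z).re ^ 2 + (g • z).im ^ 2) / (g • z).im + 1 / (g • z).im) / 2 := by
      have := (g • z).im_pos
      field_simp
  have hy := z.im_pos
  have q2 := sqrt_two_sq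
  have q3 := sqrt_three_sq
  have g00 : g 0 0 = mat 0 p 0 0 := by rw [hg]
  have g01 : g 0 1 = mat 0 p 0 1 := by rw [hg]
  have g10 : g 1 0 = mat 0 p 1 0 := by rw [hg]
  have g11 : g 1 1 = mat 0 p 1 1 := by rw [hg]
  obtain ⟨a, b, c⟩ := p
  simp only [mat, Matrix.of_apply, Matrix.cons_val', Matrix.cons_val_zero, Matrix.cons_val_one,
      Fin.isValue, Matrix.cons_val_fin_one, zero_sub, zero_add] at g00 g01 g10 g11
  have hX : √2 * (√2 * (a + b / 2 + 3 * c / 2)) = 2 * (a + b / 2 + 3 * c / 2) := by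
    linear_combination (a + b / 2 + 3 * c / 2) * q2
  have hY : √2 * √3 * (√2 * √3 / 2 * (b + c)) = 3 * (b + c) := by
    linear_combination √3 ^ 2 / 2 * (b + c) * q2 + (b + c) * q3
  have hn : (√2 * (a + b / 2 + 3 * c / 2)) ^ 2 + (√2 * √3 / 2 * (b + c)) ^ 2
      - (a + b + 3 * c) ^ 2 = 1 := by
    simp only [bil] at hp
    linear_combination (a + b / 2 + 3 * c / 2) * hX + (b + c) / 2 * hY + hp
  have hb : bil (coord z) (a, b, c) =
      √2 * (a + b / 2 + 3 * c / 2) * ((z.re ^ 2 + z.im ^ 2 - 1) / (2 * z.im))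
      + √2 * √3 / 2 * (b + c) * (z.re / z.im)
      - (a + b + 3 * c) * ((z.re ^ 2 + z.im ^ 2 + 1) / (2 * z.im)) := by
    rw [coord_eq]; simp only [bil]; ring
  rw [reflect, hb, coord_eq, coord_eq, e1, e2, h1, h2, h3, g00, g01, g10, g11]
  generalize √2 * (a + b / 2 + 3 * c / 2) = X at *
  generalize √2 * √3 / 2 * (b + c) = Y at *
  generalize hT : a + b + 3 * c = T at *
  have f1 : (((-Y * z.re + (X + T)) ^ 2 + (-Y * z.im) ^ 2) / z.im
      - (((X - T) * z.re + Y) ^ 2 + ((X - T) * z.im) ^ 2) / z.im) / 2 =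
      (z.re ^ 2 + z.im ^ 2 - 1) / (2 * z.im) - 2 * (X * ((z.re ^ 2 + z.im ^ 2 - 1) / (2 * z.im))
        + Y * (z.re / z.im) - T * ((z.re ^ 2 + z.im ^ 2 + 1) / (2 * z.im))) * X := by
    field_simp
    linear_combination (z.re ^ 2 + z.im ^ 2 - 1) * hn
  have f2 : (((-Y * z.re + (X + T)) ^ 2 + (-Y * z.im) ^ 2) / z.im
      + (((X - T) * z.re + Y) ^ 2 + ((X - T) * z.im) ^ 2) / z.im) / 2 =
      (z.re ^ 2 + z.im ^ 2 + 1) / (2 * z.im) - 2 * (X * ((z.re ^ 2 + z.im ^ 2 - 1) / (2 * z.im))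
        + Y * (z.re / z.im) - T * ((z.re ^ 2 + z.im ^ 2 + 1) / (2 * z.im))) * T := by
    field_simp
    linear_combination (z.re ^ 2 + z.im ^ 2 + 1) * hn
  have f3 : ((-Y * z.re + (X + T)) * ((X - T) * z.re + Y) + -Y * (X - T) * z.im ^ 2) / z.im =
      z.re / z.im - 2 * (X * ((z.re ^ 2 + z.im ^ 2 - 1) / (2 * z.im))
        + Y * (z.re / z.im) - T * ((z.re ^ 2 + z.im ^ 2 + 1) / (2 * z.im))) * Y := by
    field_simp
    linear_combination z.re * hn
  rw [f1, f2, f3]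
  generalize (X * ((z.re ^ 2 + z.im ^ 2 - 1) / (2 * z.im))
        + Y * (z.re / z.im) - T * ((z.re ^ 2 + z.im ^ 2 + 1) / (2 * z.im))) = h
  simp only [Prod.smul_mk, Prod.mk_sub_mk, smul_eq_mul]
  ext
  · linear_combination -2 * h * hX - 2 * h * hT
  · linear_combination -h * hX - h * hY - 2 * h * hT
  · linear_combination h * hX + h / 3 * hY + 2 * h * hT

lemma refl_smul_coord (k : ZMod 6) (z : ℍ) :
    coord (refl k • z) = reflect (toReal (root k)) (coord z) := by
  rw [refl, UpperHalfPlane.pglMk_smul]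
  exact coord_smul_of_coe_eq_mat_zero (reflMatrix_eq_mat k)
    (by rw [bil_toReal, bil_root_self, Int.cast_one]) z

/-- The displacement of a hyperbolic element with scalar part `a` and vector part `p`. -/
lemma cosh_dist_smul {g : GL (Fin 2) ℝ} {a : ℝ} {p : ℝ × ℝ × ℝ}
    (hg : (g : Matrix _ _ ℝ) = mat a p) (hp : a ^ 2 - bil p p = 1) (z : ℍ) :
    Real.cosh (dist z (g • z)) = 1 + 2 * (bil p p + bil p (coord z) ^ 2) := by
  have hdet : |g.det.val| = 1 := by
    rw [Matrix.GeneralLinearGroup.val_det_apply, hg, det_mat, hp]; norm_num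
  obtain ⟨h1, h2, h3⟩ := re_div_im_smul g hdet z
  have hy := z.im_pos
  have hd : Real.cosh (dist z (g • z)) = ((z.re ^ 2 + z.im ^ 2) / z.im * (1 / (g • z).im)
      + ((g • z).re ^ 2 + (g • z).im ^ 2) / (g • z).im * (1 / z.im)
      - 2 * (z.re / z.im) * ((g • z).re / (g • z).im)) / 2 := by
    have := (g • z).im_pos
    rw [UpperHalfPlane.cosh_dist']
    field_simp
    ring
  rw [hd, h1, h2, h3]
  have q2 := sqrt_two_sq
  have q3 := sqrt_three_sq
  have g00 : g 0 0 = mat a p 0 0 := by rw [hg]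
  have g01 : g 0 1 = mat a p 0 1 := by rw [hg]
  have g10 : g 1 0 = mat a p 1 0 := by rw [hg]
  have g11 : g 1 1 = mat a p 1 1 := by rw [hg]
  obtain ⟨x, b, c⟩ := p
  simp only [mat, Matrix.of_apply, Matrix.cons_val', Matrix.cons_val_zero, Matrix.cons_val_one,
      Fin.isValue, Matrix.cons_val_fin_one] at g00 g01 g10 g11
  have hn : (√2 * (x + b / 2 + 3 * c / 2)) ^ 2 + (√2 * √3 / 2 * (b + c)) ^ 2
      - (x + b + 3 * c) ^ 2 = bil (x, b, c) (x, b, c) := by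
    simp only [bil]
    linear_combination ((x + b / 2 + 3 * c / 2) ^ 2 + √3 ^ 2 / 4 * (b + c) ^ 2) * q2
      + (b + c) ^ 2 / 2 * q3
  have hb : bil (x, b, c) (coord z) =
      √2 * (x + b / 2 + 3 * c / 2) * ((z.re ^ 2 + z.im ^ 2 - 1) / (2 * z.im))
      + √2 * √3 / 2 * (b + c) * (z.re / z.im)
      - (x + b + 3 * c) * ((z.re ^ 2 + z.im ^ 2 + 1) / (2 * z.im)) := by
    rw [coord_eq]; simp only [bil]; ring
  rw [hb, ← hn, g00, g01, g10, g11]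
  rw [← hn] at hp
  generalize √2 * (x + b / 2 + 3 * c / 2) = X at *
  generalize √2 * √3 / 2 * (b + c) = Y at *
  generalize x + b + 3 * c = T at *
  field_simp
  linear_combination 2 * z.im ^ 2 * hp

/-! ### The integral representation of `W` -/

lemma refl_mul_self (k : ZMod 6) : refl k * refl k = 1 := by
  have key : reflMatrix k * reflMatrix k = 1 := by
    rw [reflMatrix_eq_mat, mat_mul_mat, bil_toReal, bil_root_self]
    ext i j
    fin_cases i <;> fin_cases j <;> simp [mat, wedge, mul_comm]
  rw [refl, ← map_mul, ← map_one Matrix.ProjGenLinGroup.mk]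
  congr 1
  ext i j
  simpa [Matrix.GeneralLinearGroup.mkOfDetNeZero] using congrFun (congrFun key i) j

lemma refl_inv (k : ZMod 6) : (refl k)⁻¹ = refl k := inv_eq_of_mul_eq_one_left (refl_mul_self k)

lemma W_induction {p : PGL(2, ℝ) → Prop} (one : p 1) (step : ∀ k, ∀ g ∈ W, p g → p (refl k * g)) :
    ∀ g ∈ W, p g := by
  intro g hg
  refine Subgroup.closure_induction_left (p := fun g _ => p g) one ?_ ?_ hg
  · rintro _ ⟨k, rfl⟩ g hg h
    exact step k g hg h
  · rintro _ ⟨k, rfl⟩ g hg h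
    rw [refl_inv]
    exact step k g hg h

/-- `T` is the linear map of the lattice which is dual to the isometry `g` of `ℍ`. -/
def Represents (g : PGL(2, ℝ)) (T : Module.End ℤ (ℤ × ℤ × ℤ)) : Prop :=
  ∀ v z, bil (toReal v) (coord (g • z)) = bil (toReal (T v)) (coord z)

/-- The reflection of the lattice along the root of index `k`. -/
def reflectHom (k : ZMod 6) : Module.End ℤ (ℤ × ℤ × ℤ) where
  toFun := reflect (root k)
  map_add' v w := by simp only [reflect, bil_add_left]; module
  map_smul' a v := by
    simp only [reflect, bil_smul_left, RingHom.id_apply]; module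

lemma represents_one : Represents 1 1 := fun v z => by simp

lemma represents_refl (k : ZMod 6) : Represents (refl k) (reflectHom k) := fun v z => by
  rw [refl_smul_coord, ← bil_reflect_left, ← toReal_reflect]
  rfl

/-- The order is reversed because lattice vectors act as linear forms on the hyperboloid and are
pulled back. -/
lemma Represents.mul {g g' : PGL(2, ℝ)} {T T' : Module.End ℤ (ℤ × ℤ × ℤ)}
    (h : Represents g T) (h' : Represents g' T') : Represents (g * g') (T' * T) := fun v z => by
  rw [mul_smul, h, h']
  rfl

/-- The hyperboloid spans the space: already the centre and its mirror images in the sides do. -/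
lemma eq_of_bil_coord_eq {p q : ℝ × ℝ × ℝ} (h : ∀ z, bil p (coord z) = bil q (coord z)) :
    p = q := by
  have hI := h UpperHalfPlane.I
  have hr (k : ZMod 6) : bil p (toReal (root k)) = bil q (toReal (root k)) := by
    have h1 := h (refl k • UpperHalfPlane.I)
    have h2 : bil (toReal center) (toReal (root k)) = -1 := by
      rw [bil_toReal, bil_center_root]; simp
    rw [refl_smul_coord, coord_I, reflect, h2, bil_sub_right, bil_sub_right, bil_smul_right,
      bil_smul_right, ← coord_I, hI] at h1
    linarith
  have h0 := hr 0
  have h1 := hr 1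
  rw [coord_I] at hI
  simp only [bil, toReal, center, root] at h0 h1 hI
  simp at h0 h1 hI
  ext
  · exact h0
  · exact h1
  · linarith

lemma Represents.unique {g : PGL(2, ℝ)} {T T' : Module.End ℤ (ℤ × ℤ × ℤ)}
    (h : Represents g T) (h' : Represents g T') : T = T' :=
  LinearMap.ext fun v => toReal_injective (eq_of_bil_coord_eq fun z => by rw [← h, ← h'])

/-- The sublattice modulo which the subgroup `H` acts trivially. -/
def sublattice : Submodule ℤ (ℤ × ℤ × ℤ) where
  carrier := {v | 24 ∣ v.1 ∧ 24 ∣ v.2.1 ∧ 8 ∣ v.2.2}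
  add_mem' := fun ⟨a, b, c⟩ ⟨a', b', c'⟩ => ⟨dvd_add a a', dvd_add b b', dvd_add c c'⟩
  zero_mem' := ⟨dvd_zero _, dvd_zero _, dvd_zero _⟩
  smul_mem' n _ := fun ⟨a, b, c⟩ => ⟨a.mul_left n, b.mul_left n, c.mul_left n⟩

lemma mem_sublattice {v : ℤ × ℤ × ℤ} : v ∈ sublattice ↔ 24 ∣ v.1 ∧ 24 ∣ v.2.1 ∧ 8 ∣ v.2.2 := Iff.rfl

instance (v : ℤ × ℤ × ℤ) : Decidable (v ∈ sublattice) := decidable_of_iff _ mem_sublattice.symm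

/-- The sublattice is 24 times the dual lattice of `ℤ³` for `bil`, so its products with lattice
vectors are divisible by 24. -/
lemma reflectHom_mem_sublattice (k : ZMod 6) {v : ℤ × ℤ × ℤ} (hv : v ∈ sublattice) :
    reflectHom k v ∈ sublattice := by
  refine sub_mem hv ?_
  obtain ⟨⟨a, ha⟩, ⟨b, hb⟩, ⟨c, hc⟩⟩ := hv
  have h : bil v (root k) = 24 * (a * (root k).1 + b * (root k).2.1 - c * (root k).2.2) := by
    rw [bil, ha, hb, hc]; ring
  rw [h, mem_sublattice]
  simp only [Prod.smul_fst, Prod.smul_snd, smul_eq_mul]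
  refine ⟨?_, ?_, ?_⟩
  · exact Dvd.dvd.mul_right ⟨2 * (a * (root k).1 + b * (root k).2.1 - c * (root k).2.2), by ring⟩ _
  · exact Dvd.dvd.mul_right ⟨2 * (a * (root k).1 + b * (root k).2.1 - c * (root k).2.2), by ring⟩ _
  · exact Dvd.dvd.mul_right ⟨6 * (a * (root k).1 + b * (root k).2.1 - c * (root k).2.2), by ring⟩ _

/-! ### The action of `W` on the normals modulo 4, and on the lattice modulo `sublattice`. -/

lemma reflectHom_root : ∀ k j : ZMod 6, ∃ ε : ℤˣ,
    4 ∣ (reflect (root k) (root j) - ε • root j).1 ∧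
    4 ∣ (reflect (root k) (root j) - ε • root j).2.1 ∧
    4 ∣ (reflect (root k) (root j) - ε • root j).2.2 := by
  decide

/-- Congruence modulo `4` up to sign. -/
def SignCong (v w : ℤ × ℤ × ℤ) : Prop := ∃ (ε : ℤˣ) (x : ℤ × ℤ × ℤ), v = (ε : ℤ) • w + (4 : ℤ) • x

lemma signCong_reflect_root (k j : ZMod 6) : SignCong (reflectHom k (root j)) (root j) := by
  obtain ⟨ε, ⟨a, ha⟩, ⟨b, hb⟩, ⟨c, hc⟩⟩ := reflectHom_root k j
  refine ⟨ε, (a, b, c), ?_⟩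
  change reflect (root k) (root j) = _
  generalize reflect (root k) (root j) = v at *
  ext
  · simp [Units.smul_def] at ha ⊢; linarith
  · simp [Units.smul_def] at hb ⊢; linarith
  · simp [Units.smul_def] at hc ⊢; linarith

lemma SignCong.map {T : Module.End ℤ (ℤ × ℤ × ℤ)} {v w : ℤ × ℤ × ℤ} (h : SignCong v w) :
    SignCong (T v) (T w) := by
  obtain ⟨ε, x, rfl⟩ := h
  exact ⟨ε, T x, by rw [map_add, map_smul, map_smul]⟩

lemma SignCong.trans {u v w : ℤ × ℤ × ℤ} (h : SignCong u v) (h' : SignCong v w) : SignCong u w := by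
  obtain ⟨ε, x, rfl⟩ := h
  obtain ⟨ε', x', rfl⟩ := h'
  refine ⟨ε * ε', (ε : ℤ) • x' + x, ?_⟩
  push_cast
  module

lemma exists_represents : ∀ g ∈ W, ∃ T, Represents g T ∧ (∀ v w, bil (T v) (T w) = bil v w) ∧
    (∀ k, SignCong (T (root k)) (root k)) ∧ ∀ v ∈ sublattice, T v ∈ sublattice := by
  refine W_induction ⟨1, represents_one, fun _ _ => rfl, fun k => ⟨1, 0, by simp⟩, fun v hv => hv⟩ ?_
  rintro k g - ⟨T, h1, h2, h3, h4⟩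
  refine ⟨T * reflectHom k, (represents_refl k).mul h1, fun v w => ?_, fun j => ?_, fun v hv => ?_⟩
  · exact (h2 _ _).trans (bil_reflect_reflect (bil_root_self k) v w)
  · exact (signCong_reflect_root k j).map.trans (h3 j)
  · exact h4 _ (reflectHom_mem_sublattice k hv)

/-- Together with `signCong_reflect_root` this makes the index of a side an invariant of `W`: no
element carries `Δ_j` to `Δ_k` for `j ≠ k`. -/
lemma root_injective_signCong : ∀ j k : ZMod 6, (∃ ε : ℤˣ,
    4 ∣ (root j - ε • root k).1 ∧ 4 ∣ (root j - ε • root k).2.1 ∧ 4 ∣ (root j - ε • root k).2.2) →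
    j = k := by
  decide

lemma eq_of_signCong_root {j k : ZMod 6} (h : SignCong (root j) (root k)) : j = k := by
  obtain ⟨ε, x, h⟩ := h
  refine root_injective_signCong j k ⟨ε, ?_⟩
  rw [h]
  simp [Units.smul_def]

lemma dist_smul_smul {g : PGL(2, ℝ)} (hg : g ∈ W) (z w : ℍ) : dist (g • z) (g • w) = dist z w := by
  revert z w
  refine W_induction (p := fun g => ∀ z w : ℍ, dist (g • z) (g • w) = dist z w) (by simp) ?_ g hg
  intro k g _ h z w
  rw [mul_smul, mul_smul, ← h z w]
  refine (Real.cosh_strictMonoOn.injOn dist_nonneg dist_nonneg ?_)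
  rw [cosh_dist_eq_bil, cosh_dist_eq_bil, refl_smul_coord, refl_smul_coord,
    bil_reflect_reflect (by rw [bil_toReal, bil_root_self, Int.cast_one])]

/-- The elements of `W` acting trivially modulo `sublattice`. -/
def congruenceSubgroup : Subgroup W where
  carrier := {w | ∃ T, Represents w T ∧ ∀ v, T v - v ∈ sublattice}
  one_mem' := ⟨1, represents_one, fun v => by simp⟩
  mul_mem' := by
    rintro a b ⟨T, h, hT⟩ ⟨T', h', hT'⟩
    refine ⟨T' * T, h.mul h', fun v => ?_⟩
    have := add_mem (hT' (T v)) (hT v)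
    simpa using this
  inv_mem' := by
    rintro a ⟨T, h, hT⟩
    obtain ⟨T', h', -⟩ := exists_represents _ (a⁻¹).2
    refine ⟨T', h', fun v => ?_⟩
    have e : T * T' = 1 := Represents.unique (g := 1)
      (by have := h'.mul h; rwa [← Subgroup.coe_mul, inv_mul_cancel] at this) represents_one
    have h1 := hT (T' v)
    have h2 : T (T' v) = v := LinearMap.congr_fun e v
    rw [h2] at h1
    simpa using neg_mem h1

instance : congruenceSubgroup.Normal where
  conj_mem := by
    rintro n ⟨T, h, hT⟩ g
    obtain ⟨Tg, hg, -⟩ := exists_represents _ g.2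
    obtain ⟨Ti, hi, -, -, hi'⟩ := exists_represents _ (g⁻¹).2
    refine ⟨Ti * (T * Tg), (hg.mul h).mul hi, fun v => ?_⟩
    have e : Ti * Tg = 1 := Represents.unique (g := 1)
      (by have := hg.mul hi; rwa [← Subgroup.coe_mul, mul_inv_cancel] at this) represents_one
    have h1 := hi' _ (hT (Tg v))
    -- Normality: `Ti` preserves the sublattice and undoes `Tg`, so `T` being trivial modulo the
    -- sublattice is inherited by its conjugate.
    have h2 : Ti (Tg v) = v := LinearMap.congr_fun e v
    rw [map_sub, h2] at h1
    exact h1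

lemma exists_eq_basis (v : ℤ × ℤ × ℤ) :
    v = v.1 • ((1, 0, 0) : ℤ × ℤ × ℤ) + v.2.1 • ((0, 1, 0) : ℤ × ℤ × ℤ)
      + v.2.2 • ((0, 0, 1) : ℤ × ℤ × ℤ) := by
  ext <;> simp

lemma sub_mem_sublattice_of_basis {T : Module.End ℤ (ℤ × ℤ × ℤ)}
    (h0 : T (1, 0, 0) - (1, 0, 0) ∈ sublattice) (h1 : T (0, 1, 0) - (0, 1, 0) ∈ sublattice)
    (h2 : T (0, 0, 1) - (0, 0, 1) ∈ sublattice) (v : ℤ × ℤ × ℤ) : T v - v ∈ sublattice := by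
  rw [exists_eq_basis v, map_add, map_add, map_smul, map_smul, map_smul]
  convert add_mem (add_mem (sublattice.smul_mem v.1 h0) (sublattice.smul_mem v.2.1 h1))
    (sublattice.smul_mem v.2.2 h2) using 1
  module

lemma reflect_commutator_mem : ∀ i j : ZMod 6, ∀ v ∈ ({(1, 0, 0), (0, 1, 0), (0, 0, 1)} : Finset (ℤ × ℤ × ℤ)),
    reflect (root j) (reflect (root i) (reflect (root j) (reflect (root i) v))) - v ∈ sublattice := by
  decide +kernel

lemma H_le_congruenceSubgroup : H ≤ congruenceSubgroup := by
  refine Subgroup.normalClosure_le_normal ?_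
  rintro _ ⟨i, j, rfl⟩
  refine ⟨(reflectHom j * reflectHom i) * (reflectHom j * reflectHom i), ?_, ?_⟩
  · have h := (represents_refl i).mul (represents_refl j)
    rw [sq]
    exact h.mul h
  · exact sub_mem_sublattice_of_basis (reflect_commutator_mem i j _ (by simp))
      (reflect_commutator_mem i j _ (by simp)) (reflect_commutator_mem i j _ (by simp))

/-! ### The quotient `W / H` -/

lemma Represents.pow {g : PGL(2, ℝ)} {T : Module.End ℤ (ℤ × ℤ × ℤ)} (h : Represents g T) (n : ℕ) :
    Represents (g ^ n) (T ^ n) := by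
  induction n with
  | zero => simpa using represents_one
  | succ n ih => rw [pow_succ', pow_succ]; exact h.mul ih

/-- A finite check giving the lower bound 64 for the order of `W / H`. The reflections are applied
in the order of `word` because the representation is contravariant. -/
lemma eq_zero_of_reflect_sub_mem : ∀ a b c d e f : ZMod 2,
    (∀ v ∈ ({(1, 0, 0), (0, 1, 0), (0, 0, 1)} : Finset (ℤ × ℤ × ℤ)),
      (reflect (root 5))^[f.val] ((reflect (root 4))^[e.val] ((reflect (root 3))^[d.val]
      ((reflect (root 2))^[c.val] ((reflect (root 1))^[b.val] ((reflect (root 0))^[a.val] v)))))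
        - v ∈ sublattice) →
    a = 0 ∧ b = 0 ∧ c = 0 ∧ d = 0 ∧ e = 0 ∧ f = 0 := by
  decide +kernel

/-- The product of the reflections in the sides in the support of `f`. -/
def word (f : ZMod 6 → ZMod 2) : W :=
  s 0 ^ (f 0).val * s 1 ^ (f 1).val * s 2 ^ (f 2).val * s 3 ^ (f 3).val * s 4 ^ (f 4).val
    * s 5 ^ (f 5).val

lemma eq_zero_of_word_mem {f : ZMod 6 → ZMod 2} (h : word f ∈ congruenceSubgroup) : f = 0 := by
  obtain ⟨T, hT, h⟩ := h
  have r (k : ZMod 6) := (represents_refl k).pow (f k).val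
  have e := hT.unique (((((((r 0).mul (r 1)).mul (r 2)).mul (r 3)).mul (r 4)).mul (r 5)))
  have key := eq_zero_of_reflect_sub_mem (f 0) (f 1) (f 2) (f 3) (f 4) (f 5) fun v _ => by
    have h1 := h v
    rw [e] at h1
    simp only [Module.End.mul_apply, Module.End.pow_apply] at h1
    exact h1
  obtain ⟨h0, h1, h2, h3, h4, h5⟩ := key
  funext k
  exact forall_zmod_six (p := fun k => f k = 0) h0 h1 h2 h3 h4 h5 k

lemma s_mul_self (k : ZMod 6) : s k * s k = 1 := Subtype.ext (refl_mul_self k)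

lemma W_induction' {p : W → Prop} (one : p 1) (step : ∀ k w, p w → p (s k * w)) (w : W) : p w := by
  obtain ⟨g, hg⟩ := w
  refine W_induction (p := fun g => ∀ hg : g ∈ W, p ⟨g, hg⟩) (fun _ => one) ?_ g hg hg
  intro k g hg h _
  exact step k ⟨g, hg⟩ (h hg)

lemma mk_s_mul_mk_s (i j : ZMod 6) :
    (QuotientGroup.mk (s i) : W ⧸ H) * QuotientGroup.mk (s j)
      = QuotientGroup.mk (s j) * QuotientGroup.mk (s i) := by
  rw [← QuotientGroup.mk_mul, ← QuotientGroup.mk_mul, QuotientGroup.eq]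
  have h : (s j * s i) ^ 2 ∈ H := Subgroup.subset_normalClosure ⟨j, i, rfl⟩
  -- The generators are involutions, so their commutators are squares of products and lie in `H`.
  have e : (s i * s j)⁻¹ * (s j * s i) = (s j * s i) ^ 2 := by
    rw [mul_inv_rev, inv_eq_of_mul_eq_one_left (s_mul_self i),
      inv_eq_of_mul_eq_one_left (s_mul_self j), sq]
  rwa [e]

lemma quotient_mul_comm (x y : W ⧸ H) : x * y = y * x := by
  have key (w : W) (j : ZMod 6) : Commute (QuotientGroup.mk w : W ⧸ H) (QuotientGroup.mk (s j)) := by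
    induction w using W_induction' with
    | one => exact Commute.one_left _
    | step k w h => exact Commute.mul_left (mk_s_mul_mk_s k j) h
  induction x using QuotientGroup.induction_on with | H x =>
  induction y using QuotientGroup.induction_on with | H y =>
  change Commute (QuotientGroup.mk x : W ⧸ H) (QuotientGroup.mk y)
  induction y using W_induction' with
  | one => exact Commute.one_right _
  | step k w h => exact Commute.mul_right (key x k) h

section quotient

local instance : CommGroup (W ⧸ H) :=
  { (inferInstance : Group (W ⧸ H)) with mul_comm := quotient_mul_comm }

lemma mk_word (f : ZMod 6 → ZMod 2) :
    (QuotientGroup.mk (word f) : W ⧸ H) = ∏ k, (QuotientGroup.mk (s k) : W ⧸ H) ^ (f k).val := by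
  exact (Fin.prod_univ_six (fun k : Fin 6 => (QuotientGroup.mk (s k) : W ⧸ H) ^ (f k).val)).symm

lemma pow_val_add {G : Type*} [Group G] {q : G} (hq : q * q = 1) (a b : ZMod 2) :
    q ^ (a + b).val = q ^ a.val * q ^ b.val := by
  have h : q ^ 2 = 1 := by rw [sq, hq]
  rw [← pow_add, ZMod.val_add, ← pow_mod_orderOf, ← pow_mod_orderOf q (a.val + b.val)]
  congr 1
  exact Nat.mod_mod_of_dvd _ (orderOf_dvd_of_pow_eq_one h)

/-- The homomorphism from `(ℤ/2ℤ)⁶` to `W / H`. -/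
def wordHom : Multiplicative (ZMod 6 → ZMod 2) →* W ⧸ H where
  toFun f := QuotientGroup.mk (word f.toAdd)
  map_one' := by simp [word]
  map_mul' f g := by
    rw [mk_word, mk_word, mk_word, ← Finset.prod_mul_distrib]
    refine Finset.prod_congr rfl fun k _ => pow_val_add ?_ _ _
    rw [← QuotientGroup.mk_mul, s_mul_self, QuotientGroup.mk_one]

lemma wordHom_single (k : ZMod 6) :
    wordHom (Multiplicative.ofAdd (Pi.single k 1)) = QuotientGroup.mk (s k) := by
  change (QuotientGroup.mk (word (Pi.single k 1)) : W ⧸ H) = _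
  rw [mk_word, Finset.prod_eq_single k]
  · rw [Pi.single_eq_same, show (1 : ZMod 2).val = 1 from rfl, pow_one]
  · intro j _ hj
    rw [Pi.single_eq_of_ne hj, ZMod.val_zero, pow_zero]
  · simp

end quotient

lemma wordHom_bijective : Function.Bijective wordHom := by
  constructor
  · refine (injective_iff_map_eq_one _).2 fun f hf => ?_
    exact congrArg Multiplicative.ofAdd
      (eq_zero_of_word_mem (H_le_congruenceSubgroup ((QuotientGroup.eq_one_iff _).1 hf)))
  · intro x
    induction x using QuotientGroup.induction_on with | H x =>
    induction x using W_induction' with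
    | one => exact ⟨1, map_one _⟩
    | step k w h =>
      obtain ⟨f, hf⟩ := h
      exact ⟨Multiplicative.ofAdd (Pi.single k 1) * f, by
        rw [map_mul, wordHom_single, hf, QuotientGroup.mk_mul]⟩

/-- `W / H` is elementary abelian of order `64`. -/
def quotientEquiv : (W ⧸ H) ≃* Multiplicative (ZMod 6 → ZMod 2) :=
  (MulEquiv.ofBijective wordHom wordHom_bijective).symm

/-- The class of an element of `W` in `W / H = (ℤ/2ℤ)⁶`. -/
def cls (w : W) : ZMod 6 → ZMod 2 := (quotientEquiv (QuotientGroup.mk w)).toAdd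

lemma cls_one : cls 1 = 0 := by simp [cls]

lemma cls_mul (w w' : W) : cls (w * w') = cls w + cls w' := by simp [cls]

lemma cls_inv (w : W) : cls w⁻¹ = -cls w := by simp [cls]

lemma cls_s (k : ZMod 6) : cls (s k) = Pi.single k 1 := by
  rw [cls, quotientEquiv, ← wordHom_single]
  have := (MulEquiv.ofBijective wordHom wordHom_bijective).symm_apply_apply
    (Multiplicative.ofAdd (Pi.single k 1))
  exact congrArg Multiplicative.toAdd this

lemma cls_eq_zero_iff {w : W} : cls w = 0 ↔ w ∈ H := by
  rw [← QuotientGroup.eq_one_iff, ← map_eq_one_iff quotientEquiv quotientEquiv.injective]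
  exact Iff.rfl

lemma cls_surjective : Function.Surjective cls := fun f => by
  obtain ⟨w, hw⟩ := QuotientGroup.mk_surjective (quotientEquiv.symm (Multiplicative.ofAdd f))
  exact ⟨w, by rw [cls, hw, MulEquiv.apply_symm_apply]; rfl⟩

/-- Modulo `H`, `w` is a word; that word is again in the congruence subgroup, hence trivial. So the
congruence subgroup is exactly `H`. -/
lemma cls_eq_zero_of_mem {w : W} (hw : w ∈ congruenceSubgroup) : cls w = 0 := by
  obtain ⟨f, hf⟩ := wordHom_bijective.2 (QuotientGroup.mk w)
  have h : (word f.toAdd)⁻¹ * w ∈ H := QuotientGroup.eq.1 hf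
  have h2 := mul_mem hw (inv_mem (H_le_congruenceSubgroup h))
  rw [mul_inv_rev, inv_inv, mul_inv_cancel_left] at h2
  rw [cls_eq_zero_iff]
  rw [eq_zero_of_word_mem h2] at h
  simpa [word] using h

lemma cls_eq_zero_of_forall_smul_eq {w : W} (h : ∀ z : ℍ, (w : PGL(2, ℝ)) • z = z) : cls w = 0 :=
  cls_eq_zero_of_mem ⟨1, fun v z => by rw [h]; rfl, fun v => by simp⟩

/-! ### Elements of `H` as matrices -/

/-- The elements of `W` given by a matrix with scalar part `a` and vector part `4√3 v`, with
`a` and `v` integral, of determinant `1`. -/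
def IsPrincipal (g : PGL(2, ℝ)) : Prop :=
  ∃ (a : ℤ) (v : ℤ × ℤ × ℤ) (M : GL (Fin 2) ℝ), (M : Matrix _ _ ℝ) = mat a ((4 * √3) • toReal v) ∧
    a ^ 2 - 48 * bil v v = 1 ∧ g = Matrix.ProjGenLinGroup.mk M

lemma four_sqrt_three_mul : (4 * √3) * (4 * √3) = 48 := by
  linear_combination 16 * sqrt_three_sq

lemma bil_scaled (v w : ℤ × ℤ × ℤ) :
    bil ((4 * √3) • toReal v) ((4 * √3) • toReal w) = ((48 * bil v w : ℤ) : ℝ) := by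
  rw [bil_smul_left, bil_smul_right, bil_toReal, ← mul_assoc, four_sqrt_three_mul]
  push_cast
  rfl

lemma mat_zero (a : ℝ) : mat a 0 = Matrix.diagonal fun _ => a := by
  ext i j
  fin_cases i <;> fin_cases j <;> simp [mat]

lemma toReal_zero : toReal 0 = 0 := by simp [toReal]

lemma isPrincipal_one : IsPrincipal 1 :=
  ⟨1, 0, 1, by rw [toReal_zero, smul_zero, mat_zero]; simp, by simp [bil], by simp⟩

/-- Since `(4√3)² · √3/3 = 4 · 4√3`, the vector part of a product keeps the factor `4√3`; this is
why principal elements are closed under multiplication. -/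
lemma scaled_wedge (v w : ℤ × ℤ × ℤ) :
    (√3 / 3) • wedge ((4 * √3) • toReal v) ((4 * √3) • toReal w) =
      (4 * √3) • toReal ((4 : ℤ) • wedge v w) := by
  have q3 := sqrt_three_sq
  simp only [wedge, toReal, Prod.smul_mk, smul_eq_mul]
  push_cast
  ext <;> simp only
  · linear_combination 16 * √3 * (v.2.2 * w.2.1 - v.2.1 * w.2.2) * q3
  · linear_combination 16 * √3 * (v.1 * w.2.2 - v.2.2 * w.1) * q3
  · linear_combination 16 * √3 / 3 * (v.1 * w.2.1 - v.2.1 * w.1) * q3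

lemma toReal_add (v w : ℤ × ℤ × ℤ) : toReal (v + w) = toReal v + toReal w := by simp [toReal]

lemma toReal_smul (a : ℤ) (v : ℤ × ℤ × ℤ) : toReal (a • v) = (a : ℝ) • toReal v := by simp [toReal]

lemma toReal_wedge (v w : ℤ × ℤ × ℤ) : toReal (wedge v w) = wedge (toReal v) (toReal w) := by
  simp [toReal, wedge]

lemma mat_mul_self (a : ℝ) (p : ℝ × ℝ × ℝ) :
    mat a p * mat a p = mat (a ^ 2 + bil p p) ((2 * a) • p) := by
  have h : wedge p p = 0 := by simp only [wedge]; ext <;> simp <;> ring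
  rw [mat_mul_mat, h, smul_zero, add_zero, ← sq, two_mul, add_smul]

lemma IsPrincipal.mul {g g' : PGL(2, ℝ)} (h : IsPrincipal g) (h' : IsPrincipal g') :
    IsPrincipal (g * g') := by
  obtain ⟨a, v, M, hM, hd, rfl⟩ := h
  obtain ⟨a', v', M', hM', hd', rfl⟩ := h'
  have e : ((M * M' : GL (Fin 2) ℝ) : Matrix _ _ ℝ) = mat ((a * a' + 48 * bil v v' : ℤ) : ℝ)
      ((4 * √3) • toReal (a • v' + a' • v + (4 : ℤ) • wedge v v')) := by
    rw [Units.val_mul, hM, hM', mat_mul_mat, bil_scaled, scaled_wedge]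
    simp only [toReal_add, toReal_smul]
    congr 1
    · push_cast; rfl
    · module
  refine ⟨_, _, (M * M' : GL (Fin 2) ℝ), e, ?_, by rw [map_mul]⟩
  have h1 : ((M * M' : GL (Fin 2) ℝ) : Matrix (Fin 2) (Fin 2) ℝ).det = 1 := by
    rw [Units.val_mul, Matrix.det_mul, hM, hM', det_mat, det_mat, bil_scaled, bil_scaled]
    have : ((a ^ 2 - 48 * bil v v : ℤ) : ℝ) * ((a' ^ 2 - 48 * bil v' v' : ℤ) : ℝ) = 1 := by
      rw [hd, hd']; simp
    push_cast at this ⊢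
    exact this
  rw [e, det_mat, bil_scaled] at h1
  exact_mod_cast h1

lemma IsPrincipal.inv {g : PGL(2, ℝ)} (h : IsPrincipal g) : IsPrincipal g⁻¹ := by
  obtain ⟨a, v, M, hM, hd, rfl⟩ := h
  refine ⟨a, -v, M⁻¹, ?_, by rw [bil_neg_left, bil_neg_right, neg_neg, hd], by rw [map_inv]⟩
  have h1 : (M : Matrix _ _ ℝ) * mat a ((4 * √3) • toReal (-v)) = 1 := by
    rw [hM, mat_mul_mat, bil_scaled, scaled_wedge, toReal_neg]
    have e1 : wedge v (-v) = 0 := by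
      simp only [wedge, Prod.fst_neg, Prod.snd_neg]; ext <;> simp <;> ring
    have e2 : (a * a + ((48 * bil v (-v) : ℤ) : ℝ) : ℝ) = 1 := by
      rw [bil_neg_right]; have : ((a ^ 2 - 48 * bil v v : ℤ) : ℝ) = 1 := by rw [hd]; simp
      push_cast at this ⊢; linarith
    rw [e1, e2, smul_zero, toReal_zero, smul_zero, smul_neg, smul_neg, neg_add_cancel, zero_add,
      mat_zero, Matrix.diagonal_one]
  rw [Matrix.coe_units_inv]
  exact Matrix.inv_eq_right_inv h1

/-- In a Clifford algebra, conjugation by a unit vector fixes scalars and is minus the reflection on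
vectors. -/
lemma mat_mul_mat_mul_mat {e : ℝ × ℝ × ℝ} (he : bil e e = 1) (a : ℝ) (p : ℝ × ℝ × ℝ) :
    mat 0 e * mat a p * mat 0 e = mat a (-reflect e p) := by
  have q3 := sqrt_three_sq
  rw [mat_mul_mat, mat_mul_mat]
  obtain ⟨x, y, z⟩ := e
  obtain ⟨x', y', z'⟩ := p
  simp only [reflect, bil, wedge, Prod.smul_mk, Prod.mk_add_mk, Prod.mk_sub_mk, Prod.neg_mk,
    smul_eq_mul] at he ⊢
  congr 1
  · linear_combination a * he
  · refine Prod.ext ?_ (Prod.ext ?_ ?_) <;> simp only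
    · linear_combination
        (3 * (x * y' - y * x') * y - 9 * (x * z' - z * x') * z) / 9 * q3 - x' * he
    · linear_combination
        (9 * (z * y' - y * z') * z - 3 * (x * y' - y * x') * x) / 9 * q3 - y' * he
    · linear_combination
        (3 * (z * y' - y * z') * y - 3 * (x * z' - z * x') * x) / 9 * q3 - z' * he

lemma IsPrincipal.conj_refl {g : PGL(2, ℝ)} (h : IsPrincipal g) (k : ZMod 6) :
    IsPrincipal (refl k * g * refl k) := by
  obtain ⟨a, v, M, hM, hd, rfl⟩ := h
  refine ⟨a, -reflect (root k) v, Matrix.GeneralLinearGroup.mkOfDetNeZero (reflMatrix k)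
    (by rw [det_reflMatrix]; norm_num) * M * Matrix.GeneralLinearGroup.mkOfDetNeZero (reflMatrix k)
    (by rw [det_reflMatrix]; norm_num), ?_, ?_, by rw [map_mul, map_mul]; rfl⟩
  · change reflMatrix k * (M : Matrix _ _ ℝ) * reflMatrix k = _
    have he : bil (toReal (root k)) (toReal (root k)) = 1 := by
      rw [bil_toReal, bil_root_self, Int.cast_one]
    have e2 : reflect (toReal (root k)) ((4 * √3) • toReal v) =
        (4 * √3) • reflect (toReal (root k)) (toReal v) := by
      simp only [reflect, bil_smul_left]; module
    rw [hM, reflMatrix_eq_mat, mat_mul_mat_mul_mat he, toReal_neg, toReal_reflect, smul_neg, e2]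
  · rw [bil_neg_left, bil_neg_right, neg_neg, bil_reflect_reflect (bil_root_self k), hd]

lemma IsPrincipal.conj {g : PGL(2, ℝ)} (h : IsPrincipal g) {w : PGL(2, ℝ)} (hw : w ∈ W) :
    IsPrincipal (w * g * w⁻¹) := by
  refine W_induction (p := fun w => IsPrincipal (w * g * w⁻¹)) (by simpa using h) ?_ w hw
  intro k w _ h
  have := h.conj_refl k
  rw [mul_inv_rev, refl_inv]
  simpa only [mul_assoc] using this

/-- The elements of `W` of principal type. -/
def principalSubgroup : Subgroup W where
  carrier := {w | IsPrincipal w}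
  one_mem' := isPrincipal_one
  mul_mem' h h' := h.mul h'
  inv_mem' h := h.inv

instance : principalSubgroup.Normal where
  conj_mem _ h g := h.conj g.2

/-- The square of `s_i s_j` has vector part `2 (√3/3)` times this vector; divisibility by 6 turns
that into `4√3` times a lattice vector. -/
lemma exists_wedge_root : ∀ i j : ZMod 6, ∃ a ∈ Finset.Icc (-3 : ℤ) 3, ∃ b ∈ Finset.Icc (-3 : ℤ) 3,
    ∃ c ∈ Finset.Icc (-3 : ℤ) 3, bil (root i) (root j) • wedge (root i) (root j) = (6 : ℤ) • (a, b, c) := by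
  decide +kernel

lemma H_le_principalSubgroup : H ≤ principalSubgroup := by
  refine Subgroup.normalClosure_le_normal ?_
  rintro _ ⟨i, j, rfl⟩
  obtain ⟨a, -, b, -, c, -, h⟩ := exists_wedge_root i j
  set v : ℤ × ℤ × ℤ := (a, b, c)
  set R := fun k => Matrix.GeneralLinearGroup.mkOfDetNeZero (reflMatrix k)
    (by rw [det_reflMatrix]; norm_num)
  have hij : reflMatrix i * reflMatrix j =
      mat (bil (root i) (root j) : ℤ) ((√3 / 3) • toReal (wedge (root i) (root j))) := by
    rw [reflMatrix_eq_mat, reflMatrix_eq_mat, mat_mul_mat, bil_toReal, toReal_wedge]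
    simp
  have hd : (reflMatrix i * reflMatrix j).det = 1 := by
    rw [Matrix.det_mul, det_reflMatrix, det_reflMatrix]; norm_num
  have e : ((R i * R j * (R i * R j) : GL (Fin 2) ℝ) : Matrix (Fin 2) (Fin 2) ℝ) =
      mat ((2 * bil (root i) (root j) ^ 2 - 1 : ℤ) : ℝ) ((4 * √3) • toReal v) := by
    change (reflMatrix i * reflMatrix j) * (reflMatrix i * reflMatrix j) = _
    -- Determinant 1 gives `b² - q·q = 1` for scalar part `b` and vector part `q`, so the squared
    -- matrix has scalar part `b² + q·q = 2b² - 1`.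
    rw [hij, det_mat] at hd
    rw [hij, mat_mul_self]
    congr 1
    · push_cast; linarith
    · have h' := congrArg toReal h
      rw [toReal_smul, toReal_smul] at h'
      push_cast at h' ⊢
      calc _ = (2 * (√3 / 3)) • (((bil (root i) (root j) : ℤ) : ℝ) •
            toReal (wedge (root i) (root j))) := by module
        _ = _ := by rw [h']; module
  refine ⟨_, v, _, e, ?_, ?_⟩
  · have h1 : ((R i * R j * (R i * R j) : GL (Fin 2) ℝ) : Matrix (Fin 2) (Fin 2) ℝ).det = 1 := by
      change ((reflMatrix i * reflMatrix j) * (reflMatrix i * reflMatrix j)).det = 1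
      rw [Matrix.det_mul, hd, one_mul]
    rw [e, det_mat, bil_scaled] at h1
    exact_mod_cast h1
  · rw [map_mul, map_mul, sq]; rfl

/-! ### Lattice vectors and the hexagon -/

/-- The Gram determinant of three vectors is minus a square up to a positive factor, the signature
being (2,1). Its sign is what bounds inner products below. -/
lemma gram_identity {R : Type*} [CommRing R] (p v w : R × R × R) :
    3 * (bil p p * (bil v v * bil w w - bil v w ^ 2) - bil p v * (bil p v * bil w w - bil v w * bil p w)
      + bil p w * (bil p v * bil v w - bil v v * bil p w)) = -bil p (wedge v w) ^ 2 := by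
  simp only [bil, wedge]
  ring

/-- Infinite descent at 3: since -1 is not a square modulo 3, a solution is divisible by 3. -/
lemma eq_zero_of_sq_add_sq_eq (n : ℕ) : ∀ x y z : ℤ, z.natAbs ≤ n → x ^ 2 + y ^ 2 = 3 * z ^ 2 →
    x = 0 ∧ y = 0 ∧ z = 0 := by
  induction n with
  | zero =>
    intro x y z hz h
    have hz : z = 0 := by omega
    subst hz
    refine ⟨?_, ?_, rfl⟩ <;> nlinarith [sq_nonneg x, sq_nonneg y]
  | succ n ih =>
    intro x y z hz h
    have key : ∀ a b : ZMod 3, a ^ 2 + b ^ 2 = 0 → a = 0 ∧ b = 0 := by decide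
    have h3 : ((x : ZMod 3) ^ 2 + (y : ZMod 3) ^ 2) = 0 := by
      have := congrArg (Int.cast : ℤ → ZMod 3) h
      push_cast at this
      rw [this, show (3 : ZMod 3) = 0 from rfl, zero_mul]
    obtain ⟨hx, hy⟩ := key _ _ h3
    rw [ZMod.intCast_zmod_eq_zero_iff_dvd] at hx hy
    obtain ⟨x, rfl⟩ := hx
    obtain ⟨y, rfl⟩ := hy
    have hz3 : (3 : ℤ) ∣ z ^ 2 := ⟨x ^ 2 + y ^ 2, by push_cast at h; linarith⟩
    obtain ⟨z, rfl⟩ := Int.prime_three.dvd_of_dvd_pow hz3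
    push_cast at h ⊢
    by_cases hz0 : z = 0
    · subst hz0
      have hx : x = 0 := by nlinarith [sq_nonneg x, sq_nonneg y]
      have hy : y = 0 := by nlinarith [sq_nonneg x, sq_nonneg y]
      simp [hx, hy]
    · obtain ⟨hx, hy, hz⟩ := ih x y z (by omega) (by linarith)
      simp [hx, hy, hz]

/-- The form `bil` is anisotropic over `ℤ`. -/
lemma eq_zero_of_bil_self_eq_zero {v : ℤ × ℤ × ℤ} (h : bil v v = 0) : v = 0 := by
  obtain ⟨x, y, z⟩ := v
  obtain ⟨hx, hy, hz⟩ := eq_zero_of_sq_add_sq_eq z.natAbs x y z le_rfl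
    (by simp only [bil] at h; linarith)
  simp [hx, hy, hz]

/-- Here `t` is minus the product with the centre, and `a = p.1 + t`, `b = p.2.1 + t` are
coordinates on the orthogonal plane of the centre, where the form is `(2/3)(a² - ab + b²)`. They
display the sixfold symmetry. -/
lemma norm_identity {R : Type*} [CommRing R] (p : R × R × R) (t : R) (ht : p.1 + p.2.1 + 3 * p.2.2 = t) :
    2 * ((p.1 + t) ^ 2 - (p.1 + t) * (p.2.1 + t) + (p.2.1 + t) ^ 2) = 3 * (bil p p + t ^ 2) := by
  subst ht
  simp only [bil]
  ring

lemma bil_center {R : Type*} [CommRing R] (p : R × R × R) :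
    bil (-1, -1, 1) p = -(p.1 + p.2.1 + 3 * p.2.2) := by
  simp only [bil]; ring

/-- Adding twice the square of the product with the centre flips the negative direction, so the form
becomes positive definite and bounds every coordinate. -/
lemma abs_le_of_bil_le {v : ℤ × ℤ × ℤ} {n : ℤ} (h : bil v v + 2 * bil center v ^ 2 ≤ n) :
    |v.1| ≤ 4 * n ∧ |v.2.1| ≤ 4 * n ∧ |v.2.2| ≤ 4 * n := by
  rw [show center = (-1, -1, 1) from rfl, bil_center] at h
  obtain ⟨t, ht⟩ : ∃ t, v.1 + v.2.1 + 3 * v.2.2 = t := ⟨_, rfl⟩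
  have h1 := norm_identity v t ht
  rw [ht] at h
  generalize hN : bil v v = N at *
  obtain ⟨x, y, z⟩ := v
  dsimp only at *
  have hb (s : ℤ) (hs : s ^ 2 ≤ 2 * n) : |s| ≤ 2 * n := by
    have : |s| ≤ s ^ 2 := by
      rw [← sq_abs]; nlinarith [abs_nonneg s, Int.one_le_abs (z := s), eq_or_ne s 0, Int.le_self_sq |s|]
    linarith
  have hn : 0 ≤ n := by nlinarith [sq_nonneg (x + t - 2 * (y + t)), sq_nonneg (x + t)]
  have ha := hb (x + t) (by nlinarith [sq_nonneg (x + t - 2 * (y + t)), sq_nonneg t])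
  have hb' := hb (y + t) (by nlinarith [sq_nonneg (y + t - 2 * (x + t)), sq_nonneg t])
  have hc := hb t (by nlinarith [sq_nonneg (x + t - 2 * (y + t)), sq_nonneg (x + t)])
  rw [abs_le] at ha hb' hc
  refine ⟨abs_le.2 ⟨?_, ?_⟩, abs_le.2 ⟨?_, ?_⟩, abs_le.2 ⟨?_, ?_⟩⟩ <;> omega

lemma finite_lattice (C : ℝ) :
    {v : ℤ × ℤ × ℤ | ((bil v v + 2 * bil center v ^ 2 : ℤ) : ℝ) ≤ C}.Finite := by
  obtain ⟨n, hn⟩ := exists_int_gt C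
  refine ((Set.finite_Icc (-(4 * n)) (4 * n)).prod
    ((Set.finite_Icc (-(4 * n)) (4 * n)).prod (Set.finite_Icc (-(4 * n)) (4 * n)))).subset ?_
  intro v hv
  have h : bil v v + 2 * bil center v ^ 2 ≤ n := by
    have : ((bil v v + 2 * bil center v ^ 2 : ℤ) : ℝ) ≤ (n : ℝ) := le_trans hv hn.le
    exact_mod_cast this
  obtain ⟨h1, h2, h3⟩ := abs_le_of_bil_le h
  exact ⟨abs_le.1 h1, abs_le.1 h2, abs_le.1 h3⟩

lemma eq_root_of_mem_box : ∀ x ∈ Finset.Icc (-3 : ℤ) 3, ∀ y ∈ Finset.Icc (-3 : ℤ) 3,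
    ∀ z ∈ Finset.Icc (-2 : ℤ) 2, bil (x, y, z) (x, y, z) = 1 → bil center (x, y, z) ^ 2 ≤ 2 →
    ∃ k, (x, y, z) = root k ∨ (x, y, z) = -root k := by
  decide +kernel

/-- Integrality forces `|t| ≤ 1`, then `norm_identity` confines `v` to a small box, searched by
`eq_root_of_mem_box`. -/
lemma eq_root_of_bil_center {v : ℤ × ℤ × ℤ} (hv : bil v v = 1) (hc : bil center v ^ 2 ≤ 2) :
    ∃ k, v = root k ∨ v = -root k := by
  obtain ⟨t, ht⟩ : ∃ t, v.1 + v.2.1 + 3 * v.2.2 = t := ⟨_, rfl⟩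
  have h1 := norm_identity v t ht
  have hc' := hc
  rw [show center = (-1, -1, 1) from rfl, bil_center, ht] at hc'
  rw [hv] at h1
  obtain ⟨x, y, z⟩ := v
  dsimp only at *
  have ht1 : -1 ≤ t ∧ t ≤ 1 := ⟨by nlinarith, by nlinarith⟩
  have hb (s : ℤ) (hs : s ^ 2 < 9) : -2 ≤ s ∧ s ≤ 2 := ⟨by nlinarith, by nlinarith⟩
  have ha := hb (x + t) (by nlinarith [sq_nonneg (x + t - 2 * (y + t)), sq_nonneg t])
  have hb' := hb (y + t) (by nlinarith [sq_nonneg (y + t - 2 * (x + t)), sq_nonneg t])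
  exact eq_root_of_mem_box x (Finset.mem_Icc.2 (by omega)) y (Finset.mem_Icc.2 (by omega)) z
    (Finset.mem_Icc.2 (by omega)) hv hc

lemma toReal_center : toReal center = (-1, -1, 1) := by simp [toReal, center]

/-- The circumradius of the hexagon. -/
lemma sq_bil_center_le {p : ℝ × ℝ × ℝ} (hp : ∀ k, bil (toReal (root k)) p ≤ 0) :
    bil (toReal center) p ^ 2 ≤ -3 * bil p p := by
  obtain ⟨t, ht⟩ : ∃ t, p.1 + p.2.1 + 3 * p.2.2 = t := ⟨_, rfl⟩
  have h1 := norm_identity p t ht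
  rw [toReal_center, bil_center, ht]
  have h0 := hp 0
  have h1' := hp 1
  have h2 := hp 2
  have h3 := hp 3
  have h4 := hp 4
  have h5 := hp 5
  generalize hN : bil p p = N at *
  obtain ⟨x, y, z⟩ := p
  rw [show root 0 = (1, 0, 0) from rfl] at h0
  rw [show root 1 = (0, 1, 0) from rfl] at h1'
  rw [show root 2 = (-2, 0, 1) from rfl] at h2
  rw [show root 3 = (-3, -2, 2) from rfl] at h3
  rw [show root 4 = (-2, -3, 2) from rfl] at h4
  rw [show root 5 = (0, -2, 1) from rfl] at h5
  simp only [bil, toReal] at h0 h1' h2 h3 h4 h5 ht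
  push_cast at h0 h1' h2 h3 h4 h5
  obtain ⟨a, ha⟩ : ∃ a, x + t = a := ⟨_, rfl⟩
  obtain ⟨b, hb⟩ : ∃ b, y + t = b := ⟨_, rfl⟩
  rw [ha, hb] at h1
  have k0 : a ≤ t := by linarith
  have k1 : b ≤ t := by linarith
  have k2 : b - a ≤ t := by linarith
  have k3 : -t ≤ a := by linarith
  have k4 : -t ≤ b := by linarith
  have k5 : -t ≤ b - a := by linarith
  -- The six inequalities say `|a|, |b|, |a - b| ≤ t`, a hexagon on which the quadratic form is
  -- largest at the vertices.
  have key : a ^ 2 - a * b + b ^ 2 ≤ t ^ 2 := by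
    rcases le_total 0 a with h | h <;> rcases le_total 0 b with h' | h'
    · rcases le_total a b with h'' | h'' <;> nlinarith
    · nlinarith
    · nlinarith
    · rcases le_total a b with h'' | h'' <;> nlinarith
  linarith

/-- The line orthogonal to `v` passes through a point of the hexagon, so its distance from the
centre is at most the circumradius `R`, with `sinh² R = 2`. The Gram determinant of centre, `v` and
`p` turns this into `⟨center, v⟩² ≤ 2`, and few lattice vectors remain. -/
lemma eq_root_of_bil_eq_zero {p : ℝ × ℝ × ℝ} (hp : ∀ k, bil (toReal (root k)) p ≤ 0)
    (hc : bil (toReal center) p < 0) {v : ℤ × ℤ × ℤ} (hv : bil v v = 1)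
    (h : bil (toReal v) p = 0) : ∃ k, v = root k ∨ v = -root k := by
  refine eq_root_of_bil_center hv ?_
  have h1 := sq_bil_center_le hp
  have h2 := gram_identity (toReal center) (toReal v) p
  rw [bil_toReal, bil_toReal, bil_toReal, hv, h, show bil center center = -1 from rfl] at h2
  have h3 := sq_nonneg (bil (toReal center) (wedge (toReal v) p))
  push_cast at h2
  have h4 : ((bil center v : ℤ) : ℝ) ^ 2 ≤ 2 := by
    have hpos : 0 < bil (toReal center) p ^ 2 := by nlinarith
    by_contra hcon
    push Not at hcon
    nlinarith
  exact_mod_cast h4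

/-- A root which is negative at the centre is negative on the hexagon, apart from its sides. -/
lemma bil_nonpos {p : ℝ × ℝ × ℝ} (hp : ∀ k, bil (toReal (root k)) p ≤ 0)
    (hc : bil (toReal center) p < 0) {v : ℤ × ℤ × ℤ} (hv : bil v v = 1)
    (hvc : bil center v < 0) : bil (toReal v) p ≤ 0 := by
  by_contra hcon
  push Not at hcon
  have hvc' : bil (toReal center) (toReal v) < 0 := by rw [bil_toReal]; exact_mod_cast hvc
  -- If `v` were positive at `p`, the segment from the centre to `p` would cross its orthogonal
  -- plane. This combination is the crossing point, and `v` must then be plus or minus a side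
  -- normal.
  have h1 (k : ZMod 6) : bil (toReal (root k)) (bil (toReal v) p • toReal center
      + (-bil (toReal center) (toReal v)) • p) ≤ 0 := by
    rw [bil_add_right, bil_smul_right, bil_smul_right, bil_comm _ (toReal center),
      bil_toReal center (root k), bil_center_root]
    push_cast
    nlinarith [hp k]
  have h2 : bil (toReal center) (bil (toReal v) p • toReal center
      + (-bil (toReal center) (toReal v)) • p) < 0 := by
    rw [bil_add_right, bil_smul_right, bil_smul_right, bil_toReal center center,
      show bil center center = -1 from rfl]
    push_cast
    nlinarith
  have h3 : bil (toReal v) (bil (toReal v) p • toReal center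
      + (-bil (toReal center) (toReal v)) • p) = 0 := by
    rw [bil_add_right, bil_smul_right, bil_smul_right, bil_comm (toReal v) (toReal center)]
    ring
  obtain ⟨k, rfl | rfl⟩ := eq_root_of_bil_eq_zero h1 h2 hv h3
  · exact absurd (hp k) (not_le.2 hcon)
  · rw [bil_neg_right, bil_center_root] at hvc
    norm_num at hvc

lemma bil_root_nonpos {z : ℍ} (hz : z ∈ hexagon) (k : ZMod 6) :
    bil (toReal (root k)) (coord z) ≤ 0 := by
  rw [← height_eq_bil]; exact hz k

lemma bil_center_coord_neg (z : ℍ) : bil (toReal center) (coord z) < 0 := by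
  rw [← coord_I]
  linarith [bil_coord_le UpperHalfPlane.I z]

lemma cosh_dist_I_le {z : ℍ} (hz : z ∈ hexagon) :
    Real.cosh (dist UpperHalfPlane.I z) ^ 2 ≤ 3 := by
  have h := sq_bil_center_le (bil_root_nonpos hz)
  rw [bil_coord_self] at h
  rw [cosh_dist_eq_bil, coord_I, neg_sq]
  linarith

/-! ### The hexagon is a fundamental domain -/

lemma mem_line_iff {k : ZMod 6} {z : ℍ} : z ∈ line k ↔ bil (toReal (root k)) (coord z) = 0 := by
  rw [← height_eq_bil]; exact Iff.rfl

lemma eq_of_height_eq {z w : ℍ} (h : ∀ k, height k z = height k w) : z = w :=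
  coord_injective (by rw [coord, coord, h, h, h])

lemma exists_int_cosh_dist_I {g : PGL(2, ℝ)} (hg : g ∈ W) :
    ∃ n : ℤ, Real.cosh (dist UpperHalfPlane.I (g • UpperHalfPlane.I)) = n := by
  obtain ⟨T, hT, -⟩ := exists_represents g hg
  refine ⟨-bil (T center) center, ?_⟩
  rw [cosh_dist_eq_bil, coord_I, hT, coord_I, bil_toReal]
  push_cast
  rfl

/-- Between centres, `cosh` of the distance is an integer; in the hexagon its square is at most 3,
so it is 1. -/
lemma smul_I_eq_of_mem_hexagon {g : PGL(2, ℝ)} (hg : g ∈ W) (h : g • UpperHalfPlane.I ∈ hexagon) :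
    g • UpperHalfPlane.I = UpperHalfPlane.I := by
  obtain ⟨n, hn⟩ := exists_int_cosh_dist_I hg
  have h1 := cosh_dist_I_le h
  have h2 := Real.one_le_cosh (dist UpperHalfPlane.I (g • UpperHalfPlane.I))
  rw [hn] at h1 h2
  have h1' : n ^ 2 ≤ 3 := by exact_mod_cast h1
  have h2' : 1 ≤ n := by exact_mod_cast h2
  have h3 : n = 1 := by nlinarith
  rw [h3, Int.cast_one] at hn
  exact (dist_eq_zero.1 (by_contra fun h0 => (Real.one_lt_cosh.2 h0).ne' hn)).symm

/-- Such an element permutes the side normals, and the congruence modulo 4 excludes every nontrivial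
symmetry of the hexagon. -/
lemma smul_eq_of_smul_I_eq {g : PGL(2, ℝ)} (hg : g ∈ W) (h : g • UpperHalfPlane.I = UpperHalfPlane.I)
    (z : ℍ) : g • z = z := by
  obtain ⟨T, hT, hT2, hT3, -⟩ := exists_represents g hg
  have key (k : ZMod 6) : T (root k) = root k := by
    have h1 : bil center (T (root k)) = -1 := by
      have := hT (root k) UpperHalfPlane.I
      rw [h, coord_I, bil_toReal, bil_toReal, bil_comm, bil_center_root, bil_comm] at this
      exact_mod_cast this.symm
    obtain ⟨j, hj⟩ := eq_root_of_bil_center (v := T (root k)) (by rw [hT2, bil_root_self])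
      (by rw [h1]; norm_num)
    rcases hj with hj | hj
    · have h2 := hT3 k
      rw [hj] at h2 ⊢
      rw [eq_of_signCong_root h2]
    · rw [hj, bil_neg_right, bil_center_root] at h1
      norm_num at h1
  refine eq_of_height_eq fun k => ?_
  rw [height_eq_bil, height_eq_bil, hT, key]

/-- Lines that meet have normals with product at most 1 in absolute value, and distinct sides only
have products 0, -2, -3. -/
lemma bil_root_root_of_mem_line {j k : ZMod 6} (hjk : j ≠ k) {z : ℍ} (hj : z ∈ line j)
    (hk : z ∈ line k) : bil (root k) (root j) = 0 := by
  rw [mem_line_iff, bil_comm] at hj hk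
  have h := gram_identity (coord z) (toReal (root k)) (toReal (root j))
  rw [hj, hk, bil_coord_self, bil_toReal, bil_toReal, bil_toReal, bil_root_self, bil_root_self] at h
  have h1 := sq_nonneg (bil (coord z) (wedge (toReal (root k)) (toReal (root j))))
  have h2 : ((bil (root k) (root j) : ℤ) : ℝ) ^ 2 ≤ 1 := by push_cast at h; nlinarith
  have h3 : bil (root k) (root j) ^ 2 ≤ 1 := by exact_mod_cast h2
  have key : ∀ j k : ZMod 6, j ≠ k → bil (root k) (root j) ^ 2 ≤ 1 → bil (root k) (root j) = 0 := by
    decide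
  exact key j k hjk h3

lemma reflect_of_bil_eq_zero {e v : ℤ × ℤ × ℤ} (h : bil v e = 0) : reflect e v = v := by
  simp [reflect, h]

lemma reflect_self {e : ℤ × ℤ × ℤ} (h : bil e e = 1) : reflect e e = -e := by
  rw [reflect, h]; module

/-- If `z` and `w z` both lie in the hexagon, then `w z = z` and, modulo `H`, the element `w` is a
product of reflections in sides through `z`. -/
theorem smul_eq_and_cls_eq_zero (w : W) {z : ℍ} (hz : z ∈ hexagon)
    (hwz : (w : PGL(2, ℝ)) • z ∈ hexagon) :
    (w : PGL(2, ℝ)) • z = z ∧ ∀ k, z ∉ line k → cls w k = 0 := by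
  classical
  obtain ⟨T, hT, hT2, hT3, -⟩ := exists_represents w w.2
  -- Induction on the number of sides through `w z` whose normal is negated, that is, sides
  -- separating the hexagon from its image under `w`.
  generalize hn : (Finset.univ.filter fun k => (w : PGL(2, ℝ)) • z ∈ line k ∧
    T (root k) = -root k).card = n
  induction n using Nat.strong_induction_on generalizing w T with | _ n ih =>
  have hsign (k : ZMod 6) (hk : (w : PGL(2, ℝ)) • z ∈ line k) :
      T (root k) = root k ∨ T (root k) = -root k := by
    rw [mem_line_iff, hT] at hk
    obtain ⟨j, hj⟩ := eq_root_of_bil_eq_zero (bil_root_nonpos hz) (bil_center_coord_neg z)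
      (v := T (root k)) (by rw [hT2, bil_root_self]) hk
    have hjk : j = k := by
      rcases hj with hj | hj
      · exact eq_of_signCong_root (hj ▸ hT3 k)
      · obtain ⟨ε, x, h⟩ := hj ▸ hT3 k
        exact eq_of_signCong_root ⟨-ε, -x, by rw [← neg_neg (root j), h]; push_cast; module⟩
    rwa [hjk] at hj
  by_cases hneg : ∃ j, (w : PGL(2, ℝ)) • z ∈ line j ∧ T (root j) = -root j
  · obtain ⟨j, hj, hTj⟩ := hneg
    -- Composing with `s_j` does not move `w z`. It corrects the sign at `j` and leaves the other
    -- sides through `w z` alone, since they are perpendicular to side `j`.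
    have hfix : ((s j * w : W) : PGL(2, ℝ)) • z = (w : PGL(2, ℝ)) • z := by
      rw [Subgroup.coe_mul, mul_smul]
      exact (refl_smul_eq_iff j _).2 hj
    have hzj : z ∈ line j := by
      rw [mem_line_iff, hT, hTj, toReal_neg, bil_neg_left, neg_eq_zero] at hj
      exact mem_line_iff.2 hj
    have h := ih _ ?_ (s j * w) (by rwa [hfix]) (T * reflectHom j) ((represents_refl j).mul hT)
      (fun v w => (hT2 _ _).trans (bil_reflect_reflect (bil_root_self j) v w))
      (fun i => (signCong_reflect_root j i).map.trans (hT3 i)) rfl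
    · rw [hfix] at h
      refine ⟨h.1, fun k hk => ?_⟩
      have hkj : k ≠ j := fun e => hk (e ▸ hzj)
      have := h.2 k hk
      rwa [cls_mul, Pi.add_apply, cls_s, Pi.single_eq_of_ne hkj, zero_add] at this
    · rw [← hn]
      refine Finset.card_lt_card ((Finset.ssubset_iff_of_subset ?_).2 ⟨j, ?_, ?_⟩)
      · intro k
        simp only [Finset.mem_filter, Finset.mem_univ, true_and, hfix]
        rintro ⟨hk, hk'⟩
        refine ⟨hk, ?_⟩
        by_cases hjk : j = k
        · subst hjk; exact hTj
        · change T (reflect (root j) (root k)) = _ at hk'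
          rwa [reflect_of_bil_eq_zero (bil_root_root_of_mem_line hjk hj hk)] at hk'
      · simp only [Finset.mem_filter, Finset.mem_univ, true_and]
        exact ⟨hj, hTj⟩
      · simp only [Finset.mem_filter, Finset.mem_univ, true_and, not_and]
        intro _ h
        change T (reflect (root j) (root j)) = _ at h
        rw [reflect_self (bil_root_self j), map_neg, hTj, neg_neg] at h
        have : ∀ j, root j ≠ -root j := by decide
        exact this j h
  · push Not at hneg
    -- With no sign left to correct, the image of the centre is on the inner side of every `Δ_k`:
    -- for sides through `w z` by the sign, for the others because `T (root k)` cannot change sign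
    -- between the centre and `z`.
    have hI : (w : PGL(2, ℝ)) • UpperHalfPlane.I ∈ hexagon := by
      intro k
      rw [height_eq_bil, hT, coord_I, bil_toReal, bil_comm]
      by_cases hk : (w : PGL(2, ℝ)) • z ∈ line k
      · rw [(hsign k hk).resolve_right (hneg k hk), bil_center_root]
        norm_num
      · have h1 : bil (toReal (T (root k))) (coord z) < 0 := by
          rw [← hT]
          exact lt_of_le_of_ne (bil_root_nonpos hwz k) fun h => hk (mem_line_iff.2 h)
        have h2 : bil (T (root k)) (T (root k)) = 1 := by rw [hT2, bil_root_self]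
        by_contra hcon
        push Not at hcon
        have h3 := bil_nonpos (bil_root_nonpos hz) (bil_center_coord_neg z) (v := -T (root k))
          (by rw [bil_neg_left, bil_neg_right, neg_neg, h2])
          (by rw [bil_neg_right]; have : 0 < bil center (T (root k)) := by exact_mod_cast hcon
              linarith)
        rw [toReal_neg, bil_neg_left] at h3
        linarith
    have hall := smul_eq_of_smul_I_eq w.2 (smul_I_eq_of_mem_hexagon w.2 hI)
    exact ⟨hall z, fun k _ => by rw [cls_eq_zero_of_forall_smul_eq hall]; rfl⟩

/-! ### Covering -/

lemma closure_refl_le (K : Set (ZMod 6)) : Subgroup.closure (refl '' K) ≤ W :=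
  Subgroup.closure_mono (Set.image_subset_range _ _)

lemma coord_inv_smul_I {g : PGL(2, ℝ)} (hg : g ∈ W) {T : Module.End ℤ (ℤ × ℤ × ℤ)}
    (hT : Represents g T) : coord (g⁻¹ • UpperHalfPlane.I) = toReal (T center) := by
  refine eq_of_bil_coord_eq fun z => ?_
  have h := dist_smul_smul hg (g⁻¹ • UpperHalfPlane.I) z
  rw [smul_inv_smul] at h
  rw [← hT, ← coord_I, ← neg_inj, ← cosh_dist_eq_bil, ← cosh_dist_eq_bil, h]

/-- Every point can be moved into the intersection of the half-planes of index in `K` by a product of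
the corresponding reflections. -/
theorem exists_smul_height_nonpos (K : Set (ZMod 6)) (z : ℍ) :
    ∃ g ∈ Subgroup.closure (refl '' K), ∀ k ∈ K, height k (g • z) ≤ 0 := by
  classical
  -- The vectors `T center` are the points `g⁻¹ i`. They are lattice points in a bounded region, so
  -- some `g` minimizes the distance from the centre to `g z`.
  set Y : Set (ℤ × ℤ × ℤ) := {y | ∃ g ∈ Subgroup.closure (refl '' K), ∃ T, Represents g T ∧
    y = T center ∧ dist UpperHalfPlane.I (g • z) ≤ dist UpperHalfPlane.I z} with hY
  have hfin : Y.Finite := by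
    refine (finite_lattice (-1 + 2 * Real.cosh (2 * dist UpperHalfPlane.I z) ^ 2)).subset ?_
    rintro y ⟨g, hg, T, hT, rfl, hd⟩
    have hg' := closure_refl_le K hg
    have hc := coord_inv_smul_I hg' hT
    have h1 : bil (T center) (T center) = -1 := by
      have := bil_coord_self (g⁻¹ • UpperHalfPlane.I)
      rw [hc, bil_toReal] at this
      exact_mod_cast this
    have h2 : dist UpperHalfPlane.I (g⁻¹ • UpperHalfPlane.I) ≤ 2 * dist UpperHalfPlane.I z := by
      have h3 := dist_smul_smul hg' (g⁻¹ • UpperHalfPlane.I) z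
      rw [smul_inv_smul] at h3
      have h4 := dist_triangle_right UpperHalfPlane.I (g⁻¹ • UpperHalfPlane.I) z
      linarith
    have h3 := Real.cosh_le_cosh.2 (abs_le_abs_of_nonneg dist_nonneg h2)
    have h4 := Real.cosh_pos (dist UpperHalfPlane.I (g⁻¹ • UpperHalfPlane.I))
    have h5 : Real.cosh (dist UpperHalfPlane.I (g⁻¹ • UpperHalfPlane.I)) ^ 2 ≤ _ :=
      pow_le_pow_left₀ h4.le h3 2
    rw [cosh_dist_eq_bil, hc, coord_I, bil_toReal, neg_sq] at h5
    simp only [Set.mem_ofPred_eq]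
    rw [h1]
    push_cast
    linarith
  have hne : Y.Nonempty := ⟨center, 1, one_mem _, 1, represents_one, rfl, by simp⟩
  obtain ⟨y, ⟨g, hg, T, hT, rfl, hd⟩, hmin⟩ :=
    Set.exists_min_image Y (fun y => -bil (toReal y) (coord z)) hfin hne
  refine ⟨g, hg, fun k hk => ?_⟩
  by_contra hcon
  push Not at hcon
  -- Reflecting in a side with positive height would strictly decrease the distance to the centre.
  have e1 : Real.cosh (dist UpperHalfPlane.I ((refl k * g) • z)) =
      Real.cosh (dist UpperHalfPlane.I (g • z)) - 2 * height k (g • z) := by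
    rw [cosh_dist_eq_bil, cosh_dist_eq_bil, mul_smul, refl_smul_coord, coord_I, reflect,
      bil_sub_right, bil_smul_right, bil_toReal, bil_center_root, height_eq_bil, bil_comm (coord _)]
    push_cast
    ring
  have e2 : Real.cosh (dist UpperHalfPlane.I (g • z)) = -bil (toReal (T center)) (coord z) := by
    rw [cosh_dist_eq_bil, coord_I, hT]
  have e3 : Real.cosh (dist UpperHalfPlane.I ((refl k * g) • z)) =
      -bil (toReal ((T * reflectHom k) center)) (coord z) := by
    rw [cosh_dist_eq_bil, coord_I, (represents_refl k).mul hT]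
  have h1 := hmin ((T * reflectHom k) center) ⟨refl k * g,
    mul_mem (Subgroup.subset_closure ⟨k, hk, rfl⟩) hg, _, (represents_refl k).mul hT, rfl, ?_⟩
  · rw [← e2, ← e3] at h1
    linarith
  · refine le_trans ?_ hd
    have : Real.cosh (dist UpperHalfPlane.I ((refl k * g) • z)) ≤
      Real.cosh (dist UpperHalfPlane.I (g • z)) := by linarith
    rwa [Real.cosh_le_cosh, abs_of_nonneg dist_nonneg, abs_of_nonneg dist_nonneg] at this

lemma exists_smul_mem_hexagon (z : ℍ) : ∃ g ∈ W, g • z ∈ hexagon := by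
  obtain ⟨g, hg, h⟩ := exists_smul_height_nonpos Set.univ z
  exact ⟨g, closure_refl_le _ hg, fun k => h k trivial⟩

/-! ### The tessellation of the quotient -/

lemma mem_H17_iff {g : PGL(2, ℝ)} : g ∈ H17 ↔ ∃ w : W, cls w = 0 ∧ (w : PGL(2, ℝ)) = g := by
  simp only [H17, Subgroup.mem_map, cls_eq_zero_iff]
  rfl

lemma proj_eq_iff {Γ : Subgroup PGL(2, ℝ)} {z z' : ℍ} :
    proj Γ z = proj Γ z' ↔ ∃ h ∈ Γ, h • z = z' := by
  have : proj Γ z = proj Γ z' ↔ z' ∈ MulAction.orbit Γ z := by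
    rw [eq_comm]
    exact Quotient.eq.trans MulAction.orbitRel_apply
  rw [this]
  constructor
  · rintro ⟨h, rfl⟩
    exact ⟨h, h.2, rfl⟩
  · rintro ⟨h, hh, rfl⟩
    exact ⟨⟨h, hh⟩, rfl⟩

/-- Because `H` is the kernel of `cls`, identifications in the surface become equations in
`(ℤ/2ℤ)⁶`. -/
lemma proj_smul_eq_iff {w w' : W} {z z' : ℍ} :
    proj H17 ((w : PGL(2, ℝ)) • z) = proj H17 ((w' : PGL(2, ℝ)) • z') ↔
      ∃ g : W, cls w = cls w' + cls g ∧ (g : PGL(2, ℝ)) • z = z' := by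
  rw [proj_eq_iff]
  constructor
  · rintro ⟨h, hh, e⟩
    obtain ⟨h, hc, rfl⟩ := mem_H17_iff.1 hh
    refine ⟨w'⁻¹ * h * w, ?_, ?_⟩
    · rw [cls_mul, cls_mul, cls_inv, hc]; abel
    · rw [Subgroup.coe_mul, Subgroup.coe_mul, mul_smul, mul_smul, e, Subgroup.coe_inv,
        inv_smul_smul]
  · rintro ⟨g, hg, rfl⟩
    refine ⟨_, mem_H17_iff.2 ⟨w' * g * w⁻¹, ?_, rfl⟩, ?_⟩
    · rw [cls_mul, cls_mul, cls_inv, hg, add_neg_cancel]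
    · simp only [Subgroup.coe_mul, Subgroup.coe_inv, mul_smul, inv_smul_smul]

lemma image_proj_eq {w w' g : W} {A : Set ℍ} (hA : (g : PGL(2, ℝ)) • A = A)
    (h : cls w = cls w' + cls g) :
    proj H17 '' ((w : PGL(2, ℝ)) • A) = proj H17 '' ((w' : PGL(2, ℝ)) • A) := by
  ext x
  constructor
  · rintro ⟨_, ⟨z, hz, rfl⟩, rfl⟩
    exact ⟨_, ⟨(g : PGL(2, ℝ)) • z, hA ▸ Set.smul_mem_smul_set hz, rfl⟩,
      (proj_smul_eq_iff.2 ⟨g, h, rfl⟩).symm⟩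
  · rintro ⟨_, ⟨z, hz, rfl⟩, rfl⟩
    rw [← hA] at hz
    obtain ⟨z, hz, rfl⟩ := hz
    exact ⟨_, ⟨z, hz, rfl⟩, proj_smul_eq_iff.2 ⟨g, h, rfl⟩⟩

/-! ### Counting tiles, edges and vertices. -/

lemma zmod_two_add_one {a b : ZMod 2} (h : a ≠ b) : a + 1 = b := by
  revert a b; decide

lemma eq_of_cls_eq_off {α : Type*} {F : W → α} {J : Finset (ZMod 6)}
    (h1 : ∀ w w', cls w = cls w' → F w = F w') (h2 : ∀ w, ∀ j ∈ J, F (w * s j) = F w)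
    {w w' : W} (h : ∀ j ∉ J, cls w j = cls w' j) : F w = F w' := by
  generalize hn : (Finset.univ.filter fun j => cls w j ≠ cls w' j).card = n
  induction n using Nat.strong_induction_on generalizing w with | _ n ih =>
  by_cases he : ∃ j, cls w j ≠ cls w' j
  · obtain ⟨j, hj⟩ := he
    have hJ : j ∈ J := by_contra fun hJ => hj (h j hJ)
    have hc (i : ZMod 6) : cls (w * s j) i = if i = j then cls w' i else cls w i := by
      rw [cls_mul, cls_s, Pi.add_apply]
      split_ifs with hij
      · subst hij
        rw [Pi.single_eq_same, zmod_two_add_one hj]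
      · rw [Pi.single_eq_of_ne hij, add_zero]
    rw [← h2 w j hJ]
    refine ih _ ?_ (fun i hi => ?_) rfl
    · rw [← hn]
      refine Finset.card_lt_card ((Finset.ssubset_iff_of_subset ?_).2 ⟨j, by simpa using hj, ?_⟩)
      · intro i
        simp only [Finset.mem_filter, Finset.mem_univ, true_and, hc]
        split_ifs <;> simp
      · simp [hc]
    · rw [hc]
      split_ifs
      · rfl
      · exact h i hi
  · push Not at he
    exact h1 w w' (funext he)

/-- Common counting principle: `J k` indexes the reflections that do not change the cell of type
`k`, so the cells of this type correspond to the vectors of `(ℤ/2ℤ)⁶` restricted to the complement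
of `J k`. -/
lemma ncard_eq_sum {ι α : Type*} [Fintype ι] [DecidableEq ι] {S : Set α} {F : W → ι → α}
    (hS : S = {x | ∃ w k, x = F w k}) {J : ι → Finset (ZMod 6)}
    (h1 : ∀ w w' k, cls w = cls w' → F w k = F w' k)
    (h2 : ∀ w k, ∀ j ∈ J k, F (w * s j) k = F w k)
    (h3 : ∀ w w' k k', F w k = F w' k' → k = k' ∧ ∀ j ∉ J k, cls w j = cls w' j) :
    S.Finite ∧ S.ncard = ∑ k, ∏ j, if j ∈ J k then 1 else 2 := by
  classical
  choose r hr using cls_surjective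
  set D : Finset (Σ _ : ι, ZMod 6 → ZMod 2) := Finset.univ.sigma fun k =>
    Fintype.piFinset fun j => if j ∈ J k then {0} else Finset.univ with hD
  have himg : S = (fun x : Σ _ : ι, ZMod 6 → ZMod 2 => F (r x.2) x.1) '' D := by
    rw [hS]
    ext x
    constructor
    · rintro ⟨w, k, rfl⟩
      refine ⟨⟨k, fun j => if j ∈ J k then 0 else cls w j⟩, ?_, ?_⟩
      · rw [hD, Finset.mem_coe, Finset.mem_sigma, Fintype.mem_piFinset]
        refine ⟨Finset.mem_univ _, fun j => ?_⟩
        by_cases hj : j ∈ J k <;> simp [hj]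
      · refine eq_of_cls_eq_off (F := fun w => F w k) (J := J k) (fun w w' => h1 w w' k)
          (fun w => h2 w k) fun j hj => ?_
        rw [hr]
        simp [hj]
    · rintro ⟨x, -, rfl⟩
      exact ⟨_, _, rfl⟩
  have hinj : Set.InjOn (fun x : Σ _ : ι, ZMod 6 → ZMod 2 => F (r x.2) x.1) D := by
    rintro ⟨k, a⟩ ha ⟨k', a'⟩ ha' h
    obtain ⟨hk, hc⟩ := h3 _ _ _ _ h
    dsimp only at hk hc
    subst hk
    congr 1
    funext j
    rw [hD, Finset.mem_coe, Finset.mem_sigma, Fintype.mem_piFinset] at ha ha'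
    by_cases hj : j ∈ J k
    · have e := ha.2 j
      have e' := ha'.2 j
      simp only [hj, if_true, Finset.mem_singleton] at e e'
      rw [e, e']
    · have := hc j hj
      rwa [hr, hr] at this
  rw [himg]
  refine ⟨D.finite_toSet.image _, ?_⟩
  rw [hinj.ncard_image, Set.ncard_coe_finset, hD, Finset.card_sigma]
  refine Finset.sum_congr rfl fun k _ => ?_
  rw [Fintype.card_piFinset]
  refine Finset.prod_congr rfl fun j _ => ?_
  split_ifs <;> simp

lemma I_mem_hexagon : UpperHalfPlane.I ∈ hexagon := fun k => by
  rw [height_eq_bil, coord_I, bil_comm, bil_toReal, bil_center_root]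
  norm_num

lemma I_notMem_line (k : ZMod 6) : UpperHalfPlane.I ∉ line k := fun h => by
  rw [mem_line_iff, coord_I, bil_comm, bil_toReal, bil_center_root] at h
  norm_num at h

lemma exists_mem_line_iff (k : ZMod 6) : ∃ z ∈ hexagon, ∀ j, z ∈ line j ↔ j = k := by
  have q2 := sqrt_two_sq
  have q0 : 0 < √2 := by positivity
  -- The foot of the perpendicular from the centre to `Δ_k`, which is the midpoint of the side.
  obtain ⟨z, hz⟩ := exists_coord_eq (p := (√2 / 2) • (toReal center + toReal (root k)))
    (by
      rw [bil_smul_left, bil_smul_right, bil_add_left, bil_add_right, bil_add_right,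
        bil_comm (toReal (root k)) (toReal center)]
      simp only [bil_toReal, bil_center_root, bil_root_self, show bil center center = -1 from rfl]
      push_cast
      linear_combination (-1 / 2) * q2)
    (by
      rw [bil_smul_right, bil_add_right]
      simp only [bil_toReal, bil_center_root, show bil center center = -1 from rfl]
      push_cast
      linarith)
  have hh (j : ZMod 6) : bil (toReal (root j)) (coord z) =
      √2 / 2 * ((-1 + bil (root j) (root k) : ℤ) : ℝ) := by
    rw [hz, bil_smul_right, bil_add_right, bil_comm _ (toReal center)]
    simp only [bil_toReal, bil_center_root]
    push_cast
    ring
  have key : ∀ j k : ZMod 6, -1 + bil (root j) (root k) ≤ 0 ∧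
      (-1 + bil (root j) (root k) = 0 ↔ j = k) := by decide
  refine ⟨z, fun j => ?_, fun j => ?_⟩
  · rw [height_eq_bil, hh]
    exact mul_nonpos_of_nonneg_of_nonpos (by positivity) (by exact_mod_cast (key j k).1)
  · rw [mem_line_iff, hh, mul_eq_zero, or_iff_right (by positivity), Int.cast_eq_zero, (key j k).2]

lemma tiles_eq : tiles H17 =
    {x | ∃ (w : W) (_ : Unit), x = proj H17 '' ((w : PGL(2, ℝ)) • hexagon)} := by
  ext x
  constructor
  · rintro ⟨w, hw, rfl⟩
    exact ⟨⟨w, hw⟩, (), rfl⟩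
  · rintro ⟨w, -, rfl⟩
    exact ⟨w, w.2, rfl⟩

lemma cls_eq_of_image_eq {w w' : W} (h : proj H17 '' ((w : PGL(2, ℝ)) • hexagon) =
    proj H17 '' ((w' : PGL(2, ℝ)) • hexagon)) : cls w = cls w' := by
  have hm : proj H17 ((w : PGL(2, ℝ)) • UpperHalfPlane.I) ∈
      proj H17 '' ((w' : PGL(2, ℝ)) • hexagon) :=
    h ▸ ⟨_, Set.smul_mem_smul_set I_mem_hexagon, rfl⟩
  obtain ⟨_, ⟨z, hz, rfl⟩, e⟩ := hm
  obtain ⟨g, hg, rfl⟩ := proj_smul_eq_iff.1 e.symm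
  have h0 := (smul_eq_and_cls_eq_zero g I_mem_hexagon hz).2
  rw [hg, funext fun k => h0 k (I_notMem_line k)]
  exact add_zero _

lemma one_smul_set_eq (A : Set ℍ) : ((1 : W) : PGL(2, ℝ)) • A = A := one_smul _ A

lemma image_proj_eq_of_cls_eq {w w' : W} (h : cls w = cls w') (A : Set ℍ) :
    proj H17 '' ((w : PGL(2, ℝ)) • A) = proj H17 '' ((w' : PGL(2, ℝ)) • A) :=
  image_proj_eq (one_smul_set_eq A) (by rw [cls_one, add_zero, h])

lemma tiles_finite_ncard : (tiles H17).Finite ∧ (tiles H17).ncard = 64 := by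
  have h := ncard_eq_sum (ι := Unit) tiles_eq (J := fun _ => ∅)
    (fun w w' _ h => image_proj_eq_of_cls_eq h _) (fun _ _ j hj => absurd hj (Finset.notMem_empty j))
    (fun w w' k k' h => ⟨rfl, fun j _ => by rw [cls_eq_of_image_eq h]⟩)
  refine ⟨h.1, h.2.trans ?_⟩
  decide

lemma edges_finite_ncard : (edges H17).Finite ∧ (edges H17).ncard = 192 := by
  have hE : edges H17 = {x | ∃ (w : W) (k : ZMod 6), x = proj H17 '' ((w : PGL(2, ℝ)) • side k)} := by
    ext x
    constructor
    · rintro ⟨w, hw, k, rfl⟩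
      exact ⟨⟨w, hw⟩, k, rfl⟩
    · rintro ⟨w, k, rfl⟩
      exact ⟨w, w.2, k, rfl⟩
  have h := ncard_eq_sum hE (J := fun k => {k})
    (fun w w' k h => image_proj_eq_of_cls_eq h _) (fun w k j hj => ?_) (fun w w' k k' h => ?_)
  · refine ⟨h.1, h.2.trans ?_⟩
    decide
  · rw [Finset.mem_singleton] at hj
    subst hj
    refine image_proj_eq (g := s j) ?_ (cls_mul _ _)
    have hfix : ∀ z ∈ side j, refl j • z = z := fun z hz => (refl_smul_eq_iff j z).2 hz.2
    change refl j • side j = side j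
    ext z
    constructor
    · rintro ⟨z, hz, rfl⟩
      change refl j • z ∈ side j
      rwa [hfix z hz]
    · intro hz
      exact ⟨z, hz, hfix z hz⟩
  · obtain ⟨m, hm, hmk⟩ := exists_mem_line_iff k
    have hmem : proj H17 ((w : PGL(2, ℝ)) • m) ∈ proj H17 '' ((w' : PGL(2, ℝ)) • side k') :=
      h ▸ ⟨_, Set.smul_mem_smul_set ⟨hm, (hmk k).2 rfl⟩, rfl⟩
    obtain ⟨_, ⟨z, hz, rfl⟩, e⟩ := hmem
    obtain ⟨g, hg, rfl⟩ := proj_smul_eq_iff.1 e.symm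
    obtain ⟨h1, h2⟩ := smul_eq_and_cls_eq_zero g hm hz.1
    refine ⟨((hmk k').1 (h1 ▸ hz.2)).symm, fun j hj => ?_⟩
    rw [hg, Pi.add_apply, h2 j (fun h => hj (Finset.mem_singleton.2 ((hmk j).1 h))), add_zero]

lemma vertex_mem_line_iff (k j : ZMod 6) : vertex k ∈ line j ↔ j = k - 1 ∨ j = k := by
  have h1 : vertex k ∈ line k := (vertex_mem_hexagon k).2.1
  have h2 : vertex k ∈ line (k - 1) := by
    have := (vertex_mem_hexagon (k - 1)).2.2
    rwa [sub_add_cancel] at this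
  constructor
  · intro h
    by_contra hcon
    push Not at hcon
    have e1 := bil_root_root_of_mem_line hcon.1 h h2
    have e2 := bil_root_root_of_mem_line hcon.2 h h1
    have key : ∀ k j : ZMod 6, bil (root (k - 1)) (root j) = 0 → bil (root k) (root j) = 0 → False := by
      decide
    exact key k j e1 e2
  · rintro (rfl | rfl) <;> assumption

lemma vertices_finite_ncard : (vertices H17).Finite ∧ (vertices H17).ncard = 96 := by
  have hV : vertices H17 = {x | ∃ (w : W) (k : ZMod 6), x = proj H17 ((w : PGL(2, ℝ)) • vertex k)} := by
    ext x
    constructor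
    · rintro ⟨w, hw, k, rfl⟩
      exact ⟨⟨w, hw⟩, k, rfl⟩
    · rintro ⟨w, k, rfl⟩
      exact ⟨w, w.2, k, rfl⟩
  have h := ncard_eq_sum hV (J := fun k => {k - 1, k})
    (fun w w' k h => proj_smul_eq_iff.2 ⟨1, by rw [cls_one, add_zero, h], one_smul _ _⟩)
    (fun w k j hj => ?_) (fun w w' k k' h => ?_)
  · refine ⟨h.1, h.2.trans ?_⟩
    decide
  · rw [Finset.mem_insert, Finset.mem_singleton, ← vertex_mem_line_iff] at hj
    exact proj_smul_eq_iff.2 ⟨s j, cls_mul _ _, (refl_smul_eq_iff j _).2 hj⟩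
  · obtain ⟨g, hg, e⟩ := proj_smul_eq_iff.1 h
    obtain ⟨h1, h2⟩ := smul_eq_and_cls_eq_zero g (vertex_mem_hexagon k).1
      (e ▸ (vertex_mem_hexagon k').1)
    have hk : k = k' := by
      rw [h1] at e
      have e1 := (vertex_mem_line_iff k k').1 (e ▸ (vertex_mem_hexagon k').2.1)
      have e2 := (vertex_mem_line_iff k' k).1 (e ▸ (vertex_mem_hexagon k).2.1)
      have key : ∀ k k' : ZMod 6, (k' = k - 1 ∨ k' = k) → (k = k' - 1 ∨ k = k') → k = k' := by decide
      exact key k k' e1 e2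
    refine ⟨hk, fun j hj => ?_⟩
    rw [hg, Pi.add_apply, h2 j (fun h => hj ?_), add_zero]
    rwa [Finset.mem_insert, Finset.mem_singleton, ← vertex_mem_line_iff]

/-! ### Counting the curves. -/

lemma bil_root_adjacent : ∀ k j : ZMod 6, j = k - 1 ∨ j = k + 1 → bil (root k) (root j) = 0 := by
  decide

lemma refl_smul_mem_line_iff {k j : ZMod 6} (h : j = k - 1 ∨ j = k ∨ j = k + 1) (z : ℍ) :
    refl j • z ∈ line k ↔ z ∈ line k := by
  rw [mem_line_iff, mem_line_iff, represents_refl]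
  change bil (toReal (reflect (root j) (root k))) _ = 0 ↔ _
  by_cases hjk : j = k
  · subst hjk
    rw [reflect_self (bil_root_self j), toReal_neg, bil_neg_left, neg_eq_zero]
  · rw [reflect_of_bil_eq_zero (bil_root_adjacent k j (by tauto))]

lemma mem_closure_adjacent {k : ZMod 6} {g : PGL(2, ℝ)}
    (hg : g ∈ Subgroup.closure (refl '' {k - 1, k + 1})) :
    (∀ z, g • z ∈ line k ↔ z ∈ line k) ∧
      ∃ w : W, (w : PGL(2, ℝ)) = g ∧ ∀ j, j ≠ k - 1 → j ≠ k + 1 → cls w j = 0 := by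
  induction hg using Subgroup.closure_induction with
  | mem x hx =>
    obtain ⟨i, hi, rfl⟩ := hx
    refine ⟨refl_smul_mem_line_iff (by rcases hi with h | h <;> tauto), s i, rfl, fun j h1 h2 => ?_⟩
    rw [cls_s, Pi.single_eq_of_ne]
    rintro rfl
    rcases hi with h | h <;> tauto
  | one => exact ⟨fun z => by rw [one_smul], 1, rfl, fun j _ _ => by rw [cls_one]; rfl⟩
  | mul x y _ _ hx hy =>
    obtain ⟨h1, w, rfl, hw⟩ := hx
    obtain ⟨h1', w', rfl, hw'⟩ := hy
    refine ⟨fun z => by rw [mul_smul, h1, h1'], w * w', rfl, fun j h2 h3 => ?_⟩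
    rw [cls_mul, Pi.add_apply, hw j h2 h3, hw' j h2 h3, add_zero]
  | inv x _ hx =>
    obtain ⟨h1, w, rfl, hw⟩ := hx
    refine ⟨fun z => by rw [← h1, smul_inv_smul], w⁻¹, rfl, fun j h2 h3 => ?_⟩
    rw [cls_inv, Pi.neg_apply, hw j h2 h3, neg_zero]

lemma root_eq_combination : ∀ k j : ZMod 6, ∃ a ∈ Finset.Icc (0 : ℤ) 2, ∃ b ∈ Finset.Icc (0 : ℤ) 2,
      ∃ c ∈ Finset.Icc (-3 : ℤ) 3, root j = a • root (k - 1) + b • root (k + 1) + c • root k := by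
  decide +kernel

/-- Modulo the normal of side `k`, every normal is a nonnegative combination of the two adjacent
ones. -/
lemma mem_hexagon_of_mem_line {k : ZMod 6} {z : ℍ} (hz : z ∈ line k) (h1 : height (k - 1) z ≤ 0)
    (h2 : height (k + 1) z ≤ 0) : z ∈ hexagon := by
  intro j
  obtain ⟨a, ha, b, hb, c, -, e⟩ := root_eq_combination k j
  rw [mem_line_iff] at hz
  rw [height_eq_bil] at *
  rw [e]
  simp only [toReal_add, toReal_smul, bil_add_left, bil_smul_left, hz]
  have ha' : (0 : ℝ) ≤ a := by exact_mod_cast (Finset.mem_Icc.1 ha).1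
  have hb' : (0 : ℝ) ≤ b := by exact_mod_cast (Finset.mem_Icc.1 hb).1
  nlinarith

/-- The translates of `line k` which meet the hexagon meet it along `line k`. -/
lemma eq_of_smul_mem_line {g : W} {z : ℍ} (hz : z ∈ hexagon) {k : ZMod 6}
    (h : (g : PGL(2, ℝ)) • z ∈ line k) : z ∈ line k := by
  obtain ⟨T, hT, hT2, hT3, -⟩ := exists_represents g g.2
  rw [mem_line_iff, hT] at h
  obtain ⟨j, hj⟩ := eq_root_of_bil_eq_zero (bil_root_nonpos hz) (bil_center_coord_neg z)
    (v := T (root k)) (by rw [hT2, bil_root_self]) h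
  have h3 := hT3 k
  rcases hj with hj | hj
  · rw [hj] at h3 h
    rw [← eq_of_signCong_root h3]
    exact mem_line_iff.2 h
  · rw [hj] at h3 h
    rw [toReal_neg, bil_neg_left, neg_eq_zero] at h
    obtain ⟨ε, x, h3⟩ := h3
    have hjk : j = k :=
      eq_of_signCong_root ⟨-ε, -x, by rw [← neg_neg (root j), h3]; push_cast; module⟩
    rw [← hjk]
    exact mem_line_iff.2 h

lemma curves_ncard : (curves H17).ncard = 48 := by
  have hC : curves H17 = {x | ∃ (w : W) (k : ZMod 6), x = proj H17 '' ((w : PGL(2, ℝ)) • line k)} := by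
    ext x
    constructor
    · rintro ⟨w, hw, k, rfl⟩
      exact ⟨⟨w, hw⟩, k, rfl⟩
    · rintro ⟨w, k, rfl⟩
      exact ⟨w, w.2, k, rfl⟩
  have h := ncard_eq_sum hC (J := fun k => {k - 1, k, k + 1})
    (fun w w' k h => image_proj_eq_of_cls_eq h _) (fun w k j hj => ?_) (fun w w' k k' h => ?_)
  · refine h.2.trans ?_
    decide
  · simp only [Finset.mem_insert, Finset.mem_singleton] at hj
    refine image_proj_eq (g := s j) ?_ (cls_mul _ _)
    change refl j • line k = line k
    ext z
    rw [Set.mem_smul_set_iff_inv_smul_mem, refl_inv, refl_smul_mem_line_iff hj]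
  · obtain ⟨m, hm, hmk⟩ := exists_mem_line_iff k
    have hmem : proj H17 ((w : PGL(2, ℝ)) • m) ∈ proj H17 '' ((w' : PGL(2, ℝ)) • line k') :=
      h ▸ ⟨_, Set.smul_mem_smul_set ((hmk k).2 rfl), rfl⟩
    obtain ⟨_, ⟨z, hz, rfl⟩, e⟩ := hmem
    obtain ⟨g, hg, rfl⟩ := proj_smul_eq_iff.1 e.symm
    have hk : k' = k := (hmk k').1 (eq_of_smul_mem_line hm hz)
    subst hk
    refine ⟨rfl, fun j hj => ?_⟩
    simp only [Finset.mem_insert, Finset.mem_singleton, not_or] at hj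
    -- The reflections in the adjacent sides preserve the line and bring `g m` back to the hexagon;
    -- they alter the class only at `k' - 1` and `k' + 1`.
    obtain ⟨x, hx, hx'⟩ := exists_smul_height_nonpos {k' - 1, k' + 1} ((g : PGL(2, ℝ)) • m)
    obtain ⟨h1, x, rfl, h2⟩ := mem_closure_adjacent hx
    have h3 := mem_hexagon_of_mem_line ((h1 _).2 hz) (hx' _ (by simp)) (hx' _ (by simp))
    rw [← mul_smul, ← Subgroup.coe_mul] at h3
    have h4 := (smul_eq_and_cls_eq_zero _ hm h3).2 j fun h => hj.2.1 ((hmk j).1 h)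
    rw [cls_mul, Pi.add_apply, h2 j hj.1 hj.2.2, zero_add] at h4
    rw [hg, Pi.add_apply, h4, add_zero]

/-! ### The quotient is a closed surface -/

lemma isPrincipal_of_mem_H17 {g : PGL(2, ℝ)} (hg : g ∈ H17) : IsPrincipal g := by
  obtain ⟨w, hw, rfl⟩ := hg
  exact H_le_principalSubgroup hw

lemma mk_eq_one_of_coe_eq_mat {g : PGL(2, ℝ)} {a : ℤ} {M : GL (Fin 2) ℝ}
    (hM : (M : Matrix _ _ ℝ) = mat a ((4 * √3) • toReal 0))
    (hg : g = Matrix.ProjGenLinGroup.mk M) : g = 1 := by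
  rw [toReal_zero, smul_zero, mat_zero] at hM
  have ha : (a : ℝ) ≠ 0 := by
    intro ha
    have := M.det_ne_zero
    rw [hM, ha] at this
    simp at this
  rw [hg, ← Matrix.ProjGenLinGroup.mk_scalar (n := Fin 2) (R := ℝ) (Units.mk0 (a : ℝ) ha)]
  refine congrArg _ (Units.ext ?_)
  rw [hM]
  rfl

/-- The displacement of the elements of `H`. -/
lemma exists_cosh_dist_eq {g : PGL(2, ℝ)} (hg : g ∈ H17) (hne : g ≠ 1) :
    ∃ v : ℤ × ℤ × ℤ, 1 ≤ bil v v ∧ ∀ z, Real.cosh (dist z (g • z)) =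
      1 + 96 * ((bil v v : ℤ) + bil (toReal v) (coord z) ^ 2) := by
  obtain ⟨a, v, M, hM, hd, rfl⟩ := isPrincipal_of_mem_H17 hg
  refine ⟨v, ?_, fun z => ?_⟩
  · have h0 : bil v v ≠ 0 := fun h => by
      rw [eq_zero_of_bil_self_eq_zero h] at hM
      exact hne (mk_eq_one_of_coe_eq_mat hM rfl)
    -- This is `a² ≥ 0`; it excludes negative norms, and anisotropy excludes norm 0.
    have h1 : 0 ≤ 1 + 48 * bil v v := by nlinarith [sq_nonneg a]
    omega
  · rw [UpperHalfPlane.pglMk_smul, cosh_dist_smul hM (by rw [bil_scaled]; exact_mod_cast hd),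
      bil_scaled, bil_smul_left]
    push_cast
    linear_combination 2 * bil (toReal v) (coord z) ^ 2 * four_sqrt_three_mul

lemma le_cosh_dist {g : PGL(2, ℝ)} (hg : g ∈ H17) (hne : g ≠ 1) (z : ℍ) :
    97 ≤ Real.cosh (dist z (g • z)) := by
  obtain ⟨v, hv, h⟩ := exists_cosh_dist_eq hg hne
  have hv' : (1 : ℝ) ≤ (bil v v : ℤ) := by exact_mod_cast hv
  rw [h]
  nlinarith [sq_nonneg (bil (toReal v) (coord z))]

lemma smul_ne_self {g : PGL(2, ℝ)} (hg : g ∈ H17) (hne : g ≠ 1) (z : ℍ) : g • z ≠ z := fun h => by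
  have := le_cosh_dist hg hne z
  rw [h, dist_self, Real.cosh_zero] at this
  norm_num at this

lemma H17_le_W : H17 ≤ W := by
  rintro _ ⟨w, -, rfl⟩
  exact w.2

lemma dist_I_le {z : ℍ} (hz : z ∈ hexagon) : dist UpperHalfPlane.I z ≤ Real.arcosh 2 := by
  have h := cosh_dist_I_le hz
  rw [← Real.arcosh_cosh (dist_nonneg (x := UpperHalfPlane.I) (y := z))]
  have h1 := Real.one_le_cosh (dist UpperHalfPlane.I z)
  exact (Real.arcosh_le_arcosh (by linarith) (by norm_num)).2 (by nlinarith)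

lemma isCompact_hexagon : IsCompact hexagon := by
  have hcont : ∀ k, Continuous (height k) := by
    intro k
    unfold height
    have h1 := UpperHalfPlane.continuous_re
    have h2 := UpperHalfPlane.continuous_im
    have h3 (z : ℍ) : z.im ≠ 0 := z.im_ne_zero
    have h4 (z : ℍ) : 2 * z.im ≠ 0 := mul_ne_zero two_ne_zero z.im_ne_zero
    fun_prop (disch := assumption)
  have hclosed : IsClosed hexagon := by
    have : hexagon = ⋂ k, {z | height k z ≤ 0} := by ext; simp [hexagon]
    rw [this]
    exact isClosed_iInter fun k => isClosed_le (hcont k) continuous_const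
  refine Metric.isCompact_of_isClosed_isBounded hclosed
    ((Metric.isBounded_closedBall (x := UpperHalfPlane.I) (r := Real.arcosh 2)).subset ?_)
  intro z hz
  rw [Metric.mem_closedBall, dist_comm]
  exact dist_I_le hz

lemma isometry_smul {g : PGL(2, ℝ)} (hg : g ∈ W) : Isometry fun z : ℍ => g • z :=
  Isometry.of_dist_eq fun z w => dist_smul_smul hg z w

lemma sUnion_tiles : ⋃₀ tiles H17 = Set.univ := by
  refine Set.eq_univ_of_forall fun x => ?_
  obtain ⟨z, rfl⟩ := Quotient.exists_rep x
  obtain ⟨g, hg, h⟩ := exists_smul_mem_hexagon z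
  exact ⟨_, ⟨g⁻¹, inv_mem hg, rfl⟩, z, ⟨_, h, inv_smul_smul g z⟩, rfl⟩

lemma compactSpace_surface : CompactSpace (Surface H17) := by
  rw [← isCompact_univ_iff, ← sUnion_tiles]
  refine Set.Finite.isCompact_sUnion tiles_finite_ncard.1 ?_
  rintro _ ⟨w, hw, rfl⟩
  exact (isCompact_hexagon.image (isometry_smul hw).continuous).image continuous_quotient_mk'

/-- An element of `H` is determined by its integral data `a` and `v`, and the displacement of the
centre bounds both. -/
lemma finite_dist_le (C : ℝ) :
    {g : PGL(2, ℝ) | g ∈ H17 ∧ dist UpperHalfPlane.I (g • UpperHalfPlane.I) ≤ C}.Finite := by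
  choose! a v M hM hd hg using fun (g : PGL(2, ℝ)) (hg : g ∈ H17) => isPrincipal_of_mem_H17 hg
  set n : ℤ := ⌈Real.cosh C⌉ with hn
  refine Set.Finite.of_injOn (f := fun g => (a g, v g))
    (t := Set.Icc (-(1 + 48 * n)) (1 + 48 * n) ×ˢ {v | ((bil v v + 2 * bil center v ^ 2 : ℤ) : ℝ) ≤ 2 * Real.cosh C})
    ?_ ?_ ((Set.finite_Icc _ _).prod (finite_lattice _))
  · rintro g ⟨h1, h2⟩
    have e : Real.cosh (dist UpperHalfPlane.I (g • UpperHalfPlane.I)) =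
        1 + 96 * ((bil (v g) (v g) + bil center (v g) ^ 2 : ℤ) : ℝ) := by
      conv_lhs => rw [hg g h1]
      rw [UpperHalfPlane.pglMk_smul, cosh_dist_smul (hM g h1)
        (by rw [bil_scaled]; exact_mod_cast hd g h1), bil_scaled, bil_smul_left, coord_I, bil_toReal,
        bil_comm (v g) center]
      push_cast
      linear_combination 2 * ((bil center (v g) : ℤ) : ℝ) ^ 2 * four_sqrt_three_mul
    have h3 : Real.cosh (dist UpperHalfPlane.I (g • UpperHalfPlane.I)) ≤ Real.cosh C :=
      Real.cosh_le_cosh.2 (abs_le_abs_of_nonneg dist_nonneg h2)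
    have h4 := hd g h1
    have h5 : 0 ≤ bil (v g) (v g) := by nlinarith [sq_nonneg (a g)]
    have h6 := sq_nonneg (bil center (v g))
    rw [e] at h3
    have h7 : bil (v g) (v g) + bil center (v g) ^ 2 ≤ n := by
      have h8 : ((bil (v g) (v g) + bil center (v g) ^ 2 : ℤ) : ℝ) ≤ (n : ℝ) := by
        have : (0 : ℝ) ≤ ((bil (v g) (v g) + bil center (v g) ^ 2 : ℤ) : ℝ) := by
          exact_mod_cast add_nonneg h5 h6
        linarith [Int.le_ceil (Real.cosh C)]
      exact_mod_cast h8
    refine ⟨⟨by nlinarith, by nlinarith⟩, ?_⟩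
    have h5' : (0 : ℝ) ≤ ((bil (v g) (v g) : ℤ) : ℝ) := by exact_mod_cast h5
    rw [Set.mem_ofPred_eq]
    push_cast at h3 ⊢
    nlinarith [sq_nonneg ((bil center (v g) : ℤ) : ℝ)]
  · rintro g ⟨h1, -⟩ g' ⟨h1', -⟩ h
    obtain ⟨ha, hv⟩ := Prod.mk.inj h
    rw [hg g h1, hg g' h1']
    congr 1
    exact Units.ext (by rw [hM g h1, hM g' h1', ha, hv])

lemma properlyDiscontinuous : ProperlyDiscontinuousSMul H17 ℍ where
  finite_disjoint_inter_image := by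
    intro K L hK hL
    obtain ⟨C, hC⟩ := hK.isBounded.subset_closedBall UpperHalfPlane.I
    obtain ⟨D, hD⟩ := hL.isBounded.subset_closedBall UpperHalfPlane.I
    refine ((finite_dist_le (C + D)).preimage Subtype.val_injective.injOn).subset ?_
    rintro ⟨g, hg⟩ h
    obtain ⟨_, ⟨z, hz, rfl⟩, hz'⟩ := h
    refine ⟨hg, ?_⟩
    have h1 := hC hz
    have h2 := hD hz'
    rw [Metric.mem_closedBall] at h1 h2
    have h3 := dist_triangle UpperHalfPlane.I (g • z) (g • UpperHalfPlane.I)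
    rw [dist_smul_smul (H17_le_W hg)] at h3
    have h4 : dist (g • z) UpperHalfPlane.I ≤ D := h2
    rw [dist_comm UpperHalfPlane.I (g • z)] at h3
    linarith

theorem isClosedSurfaceGroup_H17 : IsClosedSurfaceGroup H17 where
  orientation g hg := by
    obtain ⟨a, v, M, hM, hd, rfl⟩ := isPrincipal_of_mem_H17 hg
    have hdet : (M : Matrix (Fin 2) (Fin 2) ℝ).det = 1 := by
      rw [hM, det_mat, bil_scaled]; exact_mod_cast hd
    refine ⟨⟨M, hdet⟩, fun z => ?_⟩
    rw [UpperHalfPlane.pglMk_smul]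
    change M • z = Matrix.SpecialLinearGroup.mapGL ℝ (⟨M, hdet⟩ : SL(2, ℝ)) • z
    congr 1
    ext i j
    rfl
  free g hg z h := by_contra fun hne => smul_ne_self hg hne z h
  discontinuous := properlyDiscontinuous
  compact := compactSpace_surface

theorem isTessellated_H17 : IsTessellated H17 where
  embedded := by
    rintro w hw _ ⟨z, hz, rfl⟩ _ ⟨z', hz', rfl⟩ h
    obtain ⟨g, hg, e⟩ := proj_eq_iff.1 h
    by_contra hne
    have hg1 : g ≠ 1 := by
      rintro rfl
      rw [one_smul] at e
      exact hne e
    have h1 := le_cosh_dist hg hg1 (w • z)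
    have e' : g • w • z = w • z' := e
    rw [e', dist_smul_smul hw] at h1
    -- Two points of one hexagon are at distance at most `2 arcosh 2`, with `cosh` equal to 7, far
    -- below 97.
    have h2 : dist z z' ≤ 2 * Real.arcosh 2 := by
      linarith [dist_triangle_left z z' UpperHalfPlane.I, dist_I_le hz, dist_I_le hz']
    have h3 := Real.cosh_le_cosh.2 (abs_le_abs_of_nonneg dist_nonneg h2)
    rw [Real.cosh_two_mul, Real.sinh_sq, Real.cosh_arcosh (by norm_num)] at h3
    linarith
  cover := sUnion_tiles
  inter := by
    rintro _ ⟨w, hw, rfl⟩ _ ⟨w', hw', rfl⟩ hne x ⟨⟨_, ⟨z, hz, rfl⟩, rfl⟩, ⟨_, ⟨z', hz', rfl⟩, e⟩⟩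
    by_cases hl : ∃ k, z ∈ line k
    · obtain ⟨k, hk⟩ := hl
      exact ⟨_, ⟨w, hw, k, rfl⟩, _, ⟨z, ⟨hz, hk⟩, rfl⟩, rfl⟩
    · push Not at hl
      refine absurd ?_ hne
      obtain ⟨g, hg, rfl⟩ := proj_smul_eq_iff (w := ⟨w, hw⟩) (w' := ⟨w', hw'⟩).1 e.symm
      have h0 := (smul_eq_and_cls_eq_zero g hz hz').2
      refine image_proj_eq_of_cls_eq (w := ⟨w, hw⟩) (w' := ⟨w', hw'⟩) ?_ _
      rw [hg, funext fun k => h0 k (hl k)]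
      exact add_zero _

theorem hasGenus_H17 : HasGenus H17 17 := by
  refine ⟨vertices_finite_ncard.1, edges_finite_ncard.1, tiles_finite_ncard.1, ?_⟩
  rw [vertices_finite_ncard.2, edges_finite_ncard.2, tiles_finite_ncard.2]
  norm_num

/-! ### Geodesics -/

/-- The form is positive definite on the orthogonal complement of a timelike vector. -/
lemma eq_zero_of_bil_coord_eq_zero {p : ℝ × ℝ × ℝ} {z : ℍ} (h : bil p (coord z) = 0)
    (hp : bil p p = 0) : p = 0 := by
  have hz := bil_coord_self z
  obtain ⟨x, y, t⟩ := p
  generalize coord z = q at *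
  obtain ⟨a, b, c⟩ := q
  simp only [bil] at h hp hz
  have h1 : (x * a + y * b) ^ 2 = 9 * t ^ 2 * c ^ 2 := by
    rw [show x * a + y * b = 3 * (t * c) by linarith]; ring
  have h2 : (x ^ 2 + y ^ 2) * (a ^ 2 + b ^ 2) = 3 * t ^ 2 * (3 * c ^ 2 - 1) := by
    rw [show x ^ 2 + y ^ 2 = 3 * t ^ 2 by linarith, show a ^ 2 + b ^ 2 = 3 * c ^ 2 - 1 by linarith]
  have ht : t ^ 2 = 0 := by nlinarith [sq_nonneg (x * b - y * a), sq_nonneg t]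
  have hx : x ^ 2 = 0 := by nlinarith [sq_nonneg x, sq_nonneg y]
  have hy : y ^ 2 = 0 := by nlinarith [sq_nonneg x, sq_nonneg y]
  simp [pow_eq_zero_iff two_ne_zero |>.1 ht, pow_eq_zero_iff two_ne_zero |>.1 hx,
    pow_eq_zero_iff two_ne_zero |>.1 hy]

lemma bil_coord_of_isometry {γ : ℝ → ℍ} (hγ : Isometry γ) (t u : ℝ) :
    bil (coord (γ t)) (coord (γ u)) = -Real.cosh (t - u) := by
  rw [← neg_eq_iff_eq_neg, ← cosh_dist_eq_bil, hγ.dist_eq, Real.dist_eq, Real.cosh_abs]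

/-- A geodesic lies in the plane spanned by any two of its points. -/
lemma sinh_smul_coord {γ : ℝ → ℍ} (hγ : Isometry γ) (t u : ℝ) :
    Real.sinh u • coord (γ t) =
      Real.sinh (u - t) • coord (γ 0) + Real.sinh t • coord (γ u) := by
  have h := bil_coord_of_isometry hγ
  rw [← sub_eq_zero]
  have htt := h t t
  have h00 := h 0 0
  have huu := h u u
  have ht0 := h t 0
  have h0t := h 0 t
  have htu := h t u
  have hut := h u t
  have h0u := h 0 u
  have hu0 := h u 0
  have ct := Real.cosh_sq t
  have cu := Real.cosh_sq u
  simp only [sub_self, Real.cosh_zero, sub_zero, zero_sub, Real.cosh_neg, Real.cosh_sub] at *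
  have e (w : ℍ) : bil (Real.sinh u • coord (γ t) -
      (Real.sinh (u - t) • coord (γ 0) + Real.sinh t • coord (γ u))) (coord w) =
      Real.sinh u * bil (coord (γ t)) (coord w) - ((Real.sinh u * Real.cosh t
        - Real.cosh u * Real.sinh t) * bil (coord (γ 0)) (coord w)
        + Real.sinh t * bil (coord (γ u)) (coord w)) := by
    rw [bil_sub_left, bil_add_left, bil_smul_left, bil_smul_left, bil_smul_left, Real.sinh_sub]
  have e0 := e (γ 0)
  have et := e (γ t)
  have eu := e (γ u)
  rw [ht0, h00, hu0] at e0
  rw [htt, h0t, hut] at et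
  rw [htu, h0u, huu] at eu
  -- The difference of the two sides is orthogonal to `γ 0` and has norm 0.
  refine eq_zero_of_bil_coord_eq_zero (z := γ 0) (by rw [e0]; ring) ?_
  rw [bil_sub_right, bil_add_right, bil_smul_right, bil_smul_right, bil_smul_right, e0, et, eu]
  generalize Real.sinh t = a at *
  generalize Real.sinh u = b at *
  generalize Real.cosh t = c at *
  generalize Real.cosh u = d at *
  linear_combination b ^ 2 * ct + a ^ 2 * cu

lemma eq_zero_of_forall_bil_root {p : ℝ × ℝ × ℝ} (k : ZMod 6)
    (h0 : bil (toReal (root (k - 1))) p = 0)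
    (h1 : bil (toReal (root k)) p = 0) (h2 : bil (toReal (root (k + 1))) p = 0) : p = 0 := by
  have key (j : ZMod 6) : bil (toReal (root j)) p = 0 := by
    obtain ⟨a, -, b, -, c, -, e⟩ := root_eq_combination k j
    rw [e]
    simp only [toReal_add, toReal_smul, bil_add_left, bil_smul_left, h0, h1, h2]
    ring
  have e0 := key 0
  have e1 := key 1
  have e2 := key 2
  rw [show root 0 = (1, 0, 0) from rfl] at e0
  rw [show root 1 = (0, 1, 0) from rfl] at e1
  rw [show root 2 = (-2, 0, 1) from rfl] at e2
  simp only [bil, toReal] at e0 e1 e2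
  push_cast at e0 e1 e2
  ext
  · simp only [Prod.fst_zero]; linarith
  · simp only [Prod.fst_zero, Prod.snd_zero]; linarith
  · simp only [Prod.snd_zero]; linarith

lemma cosh_arcosh_two : Real.cosh (Real.arcosh 2) = 2 := Real.cosh_arcosh (by norm_num)

lemma sinh_arcosh_two : Real.sinh (Real.arcosh 2) = √3 := by
  rw [Real.sinh_arcosh (by norm_num)]; norm_num

/-- The line `line k` as a geodesic, with the action of the reflections in the adjacent sides. -/
lemma exists_geodesic_line (k : ZMod 6) : ∃ δ : ℝ → ℍ, Isometry δ ∧ Set.range δ = line k ∧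
    (∀ t, refl (k + 1) • δ t = δ (Real.arcosh 2 - t)) ∧
    ∀ t, refl (k - 1) • δ t = δ (-Real.arcosh 2 - t) := by
  have q2 := sqrt_two_sq
  have q3 := sqrt_three_sq
  have q0 : 0 < √2 := by positivity
  obtain ⟨A, hA⟩ : ∃ A, toReal (root (k - 1)) = A := ⟨_, rfl⟩
  obtain ⟨B, hB⟩ : ∃ B, toReal (root (k + 1)) = B := ⟨_, rfl⟩
  have key : ∀ k : ZMod 6, bil (root (k - 1)) (root (k + 1)) = -2 ∧
      bil (root k) (root (k - 1)) = 0 ∧ bil (root k) (root (k + 1)) = 0 := by decide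
  have hAA : bil A A = 1 := by rw [← hA, bil_toReal, bil_root_self]; simp
  have hBB : bil B B = 1 := by rw [← hB, bil_toReal, bil_root_self]; simp
  have hAB : bil A B = -2 := by rw [← hA, ← hB, bil_toReal, (key k).1]; simp
  have hBA : bil B A = -2 := by rw [bil_comm, hAB]
  have hcA : bil (toReal center) A = -1 := by rw [← hA, bil_toReal, bil_center_root]; simp
  have hcB : bil (toReal center) B = -1 := by rw [← hB, bil_toReal, bil_center_root]; simp
  have hkA : bil (toReal (root k)) A = 0 := by rw [← hA, bil_toReal, (key k).2.1]; simp
  have hkB : bil (toReal (root k)) B = 0 := by rw [← hB, bil_toReal, (key k).2.2]; simp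
  -- `P` is the midpoint of the side and `Q` the unit tangent there. The ends of the side lie at
  -- parameters `± arcosh 2 / 2`, about which the adjacent reflections flip the line.
  obtain ⟨P, hP⟩ : ∃ P, (√2 / 2) • (A + B) = P := ⟨_, rfl⟩
  obtain ⟨Q, hQ⟩ : ∃ Q, (√2 * √3 / 6) • (B - A) = Q := ⟨_, rfl⟩
  have hPP : bil P P = -1 := by
    simp only [← hP, bil_smul_left, bil_smul_right, bil_add_left, bil_add_right, hAA, hBB, hAB, hBA]
    linear_combination (-1 / 2) * q2
  have hQQ : bil Q Q = 1 := by
    simp only [← hQ, bil_smul_left, bil_smul_right, bil_sub_left, bil_sub_right, hAA, hBB, hAB, hBA]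
    linear_combination √3 ^ 2 / 6 * q2 + 1 / 3 * q3
  have hPQ : bil P Q = 0 := by
    simp only [← hP, ← hQ, bil_smul_left, bil_smul_right, bil_add_left, bil_sub_right, hAA, hBB,
      hAB, hBA]
    ring
  have hQP : bil Q P = 0 := by rw [bil_comm, hPQ]
  have hcP : bil (toReal center) P = -√2 := by
    simp only [← hP, bil_smul_right, bil_add_right, hcA, hcB]; ring
  have hcQ : bil (toReal center) Q = 0 := by
    simp only [← hQ, bil_smul_right, bil_sub_right, hcA, hcB]; ring
  have hkP : bil (toReal (root k)) P = 0 := by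
    simp only [← hP, bil_smul_right, bil_add_right, hkA, hkB]; ring
  have hkQ : bil (toReal (root k)) Q = 0 := by
    simp only [← hQ, bil_smul_right, bil_sub_right, hkA, hkB]; ring
  have hAPQ : A = (√2 / 2) • P - (√2 * √3 / 2) • Q := by
    rw [← hP, ← hQ]
    have e1 : √2 / 2 * (√2 / 2) = 1 / 2 := by linear_combination 1 / 4 * q2
    have e2 : √2 * √3 / 2 * (√2 * √3 / 6) = 1 / 2 := by
      linear_combination √3 ^ 2 / 12 * q2 + 1 / 6 * q3
    rw [smul_smul, smul_smul, e1, e2]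
    module
  have hBPQ : B = (√2 / 2) • P + (√2 * √3 / 2) • Q := by
    rw [← hP, ← hQ]
    have e1 : √2 / 2 * (√2 / 2) = 1 / 2 := by linear_combination 1 / 4 * q2
    have e2 : √2 * √3 / 2 * (√2 * √3 / 6) = 1 / 2 := by
      linear_combination √3 ^ 2 / 12 * q2 + 1 / 6 * q3
    rw [smul_smul, smul_smul, e1, e2]
    module
  clear hP hQ
  have hex (t : ℝ) : ∃ z, coord z = Real.cosh t • P + Real.sinh t • Q := by
    apply exists_coord_eq
    · simp only [bil_smul_left, bil_smul_right, bil_add_left, bil_add_right, hPP, hQQ, hPQ, hQP]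
      linear_combination -Real.cosh_sq t
    · simp only [bil_smul_right, bil_add_right, hcP, hcQ]
      have := Real.cosh_pos t
      nlinarith
  choose δ hδ using hex
  refine ⟨δ, Isometry.of_dist_eq fun t u => ?_, ?_, fun t => coord_injective ?_,
    fun t => coord_injective ?_⟩
  · refine Real.cosh_strictMonoOn.injOn dist_nonneg dist_nonneg ?_
    rw [cosh_dist_eq_bil, hδ, hδ, Real.dist_eq, Real.cosh_abs, Real.cosh_sub]
    simp only [bil_smul_left, bil_smul_right, bil_add_left, bil_add_right, hPP, hQQ, hPQ, hQP]
    ring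
  · ext z
    rw [mem_line_iff]
    constructor
    · rintro ⟨t, rfl⟩
      simp only [hδ, bil_smul_right, bil_add_right, hkP, hkQ]
      ring
    · intro hz
      obtain ⟨α, hα⟩ : ∃ α, -bil P (coord z) = α := ⟨_, rfl⟩
      obtain ⟨β, hβ⟩ : ∃ β, bil Q (coord z) = β := ⟨_, rfl⟩
      have hα0 : 0 < α := by
        have h := bil_coord_le (δ 0) z
        rw [hδ] at h
        simp only [Real.cosh_zero, Real.sinh_zero, one_smul, zero_smul, add_zero] at h
        linarith
      have hY : coord z - (α • P + β • Q) = 0 := by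
        refine eq_zero_of_forall_bil_root k ?_ ?_ ?_
        · rw [hA, hAPQ]
          simp only [bil_sub_right, bil_add_right, bil_smul_right, bil_sub_left, bil_smul_left, hPP,
            hQQ, hPQ, hQP, hβ, ← hα]
          ring
        · simp only [bil_sub_right, bil_add_right, bil_smul_right, hkP, hkQ, hz]
          ring
        · rw [hB, hBPQ]
          simp only [bil_sub_right, bil_add_right, bil_smul_right, bil_add_left, bil_smul_left, hPP,
            hQQ, hPQ, hQP, hβ, ← hα]
          ring
      rw [sub_eq_zero] at hY
      have hn := bil_coord_self z
      rw [hY] at hn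
      simp only [bil_smul_left, bil_smul_right, bil_add_left, bil_add_right, hPP, hQQ, hPQ, hQP] at hn
      refine ⟨Real.arsinh β, coord_injective ?_⟩
      have hα' : √(1 + β ^ 2) = α := by
        rw [show 1 + β ^ 2 = α ^ 2 by linarith, Real.sqrt_sq hα0.le]
      rw [hδ, Real.sinh_arsinh, Real.cosh_arsinh, hα', hY]
  · rw [refl_smul_coord, hδ, hδ, Real.cosh_sub, Real.sinh_sub, cosh_arcosh_two, sinh_arcosh_two, hB,
      reflect]
    have e : bil (Real.cosh t • P + Real.sinh t • Q) B =
        √2 / 2 * (√3 * Real.sinh t - Real.cosh t) := by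
      rw [hBPQ]
      simp only [bil_smul_left, bil_smul_right, bil_add_left, bil_add_right, hPP, hQQ, hPQ, hQP]
      ring
    rw [e, hBPQ]
    generalize Real.cosh t = x
    generalize Real.sinh t = y
    have c1 : 2 * (√2 / 2 * (√3 * y - x)) * (√2 / 2) = √3 * y - x := by
      linear_combination 1 / 2 * (√3 * y - x) * q2
    have c2 : 2 * (√2 / 2 * (√3 * y - x)) * (√2 * √3 / 2) = 3 * y - √3 * x := by
      linear_combination √3 / 2 * (√3 * y - x) * q2 + y * q3
    rw [smul_add, smul_smul, smul_smul, c1, c2]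
    module
  · rw [refl_smul_coord, hδ, hδ, Real.cosh_sub, Real.sinh_sub, Real.cosh_neg, Real.sinh_neg,
      cosh_arcosh_two, sinh_arcosh_two, hA, reflect]
    have e : bil (Real.cosh t • P + Real.sinh t • Q) A =
        -(√2 / 2 * (√3 * Real.sinh t + Real.cosh t)) := by
      rw [hAPQ]
      simp only [bil_smul_left, bil_smul_right, bil_add_left, bil_sub_right, hPP, hQQ, hPQ, hQP]
      ring
    rw [e, hAPQ]
    generalize Real.cosh t = x
    generalize Real.sinh t = y
    have c1 : 2 * -(√2 / 2 * (√3 * y + x)) * (√2 / 2) = -(√3 * y + x) := by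
      linear_combination -1 / 2 * (√3 * y + x) * q2
    have c2 : 2 * -(√2 / 2 * (√3 * y + x)) * (√2 * √3 / 2) = -(3 * y + √3 * x) := by
      linear_combination -√3 / 2 * (√3 * y + x) * q2 - y * q3
    rw [smul_sub, smul_smul, smul_smul, c1, c2]
    module

lemma surjective_of_isometry_real {u : ℝ → ℝ} (hu : Isometry u) : Function.Surjective u := by
  intro y
  have h (a b : ℝ) : |u a - u b| = |a - b| := by
    rw [← Real.dist_eq, hu.dist_eq, Real.dist_eq]
  obtain ⟨d, hd⟩ : ∃ d, |y - u 0| = d := ⟨_, rfl⟩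
  have h0 : 0 ≤ d := hd ▸ abs_nonneg _
  have h1 := h d 0
  have h2 := h (-d) 0
  have h3 := h d (-d)
  rw [sub_zero, abs_of_nonneg h0] at h1
  rw [sub_zero, abs_neg, abs_of_nonneg h0] at h2
  rw [sub_neg_eq_add, abs_of_nonneg (by linarith : 0 ≤ d + d)] at h3
  by_cases hy : u d = y
  · exact ⟨d, hy⟩
  · refine ⟨-d, ?_⟩
    rcases abs_cases (u d - u 0) with ⟨a1, _⟩ | ⟨a1, _⟩ <;>
    rcases abs_cases (u (-d) - u 0) with ⟨a2, _⟩ | ⟨a2, _⟩ <;>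
    rcases abs_cases (u d - u (-d)) with ⟨a3, _⟩ | ⟨a3, _⟩ <;>
    rcases abs_cases (y - u 0) with ⟨a4, _⟩ | ⟨a4, _⟩ <;>
    first
    | linarith
    | exact absurd (by linarith) hy

/-- A geodesic line contained in `line k` is all of it. -/
lemma range_eq_line {γ : ℝ → ℍ} (hγ : Isometry γ) {k : ZMod 6} (h : ∀ t, γ t ∈ line k) :
    Set.range γ = line k := by
  obtain ⟨δ, hδ, hr, -⟩ := exists_geodesic_line k
  have hex (t : ℝ) : ∃ u, δ u = γ t := by
    have := h t
    rwa [← hr] at this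
  choose u hu using hex
  have hui : Isometry u := Isometry.of_dist_eq fun a b => by
    rw [← hδ.dist_eq, hu, hu, hγ.dist_eq]
  refine subset_antisymm (Set.range_subset_iff.2 h) ?_
  rw [← hr]
  rintro _ ⟨t, rfl⟩
  obtain ⟨a, rfl⟩ := surjective_of_isometry_real hui t
  exact ⟨a, (hu a).symm⟩

/-- The sides `k - 1` and `k + 1` are perpendicular to `Δ_k` at distance `arcosh 2`, so `s_{k+1}
s_{k-1}` translates along it by `2 arcosh 2`, and its square is in `H`. -/
lemma isClosedGeodesic_curve (w : W) (k : ZMod 6) : ∃ c, IsClosedGeodesic H17 c (4 * Real.arcosh 2) ∧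
    Set.range c = proj H17 '' ((w : PGL(2, ℝ)) • line k) := by
  obtain ⟨δ, hδ, hr, h1, h2⟩ := exists_geodesic_line k
  refine ⟨proj H17 ∘ fun t => (w : PGL(2, ℝ)) • δ t, ⟨?_, fun t => ?_, _,
    (isometry_smul w.2).comp hδ, rfl⟩, ?_⟩
  · have := Real.arcosh_pos (x := 2) (by norm_num)
    linarith
  · refine (proj_smul_eq_iff.2 ⟨(s (k + 1) * s (k - 1)) ^ 2, ?_, ?_⟩).symm
    · have : cls ((s (k + 1) * s (k - 1)) ^ 2) = 0 :=
        cls_eq_zero_iff.2 (Subgroup.subset_normalClosure ⟨_, _, rfl⟩)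
      rw [this, add_zero]
    · change ((refl (k + 1) * refl (k - 1)) ^ 2) • δ t = _
      rw [sq, mul_smul, mul_smul, mul_smul, h2, h1, h2, h1]
      congr 1
      ring
  · rw [Set.range_comp, ← hr]
    congr 1
    exact Set.range_comp (fun z => (w : PGL(2, ℝ)) • z) δ

/-! ### The minimal length and its equality case. -/

lemma cosh_four_mul_arcosh_two : Real.cosh (4 * Real.arcosh 2) = 97 := by
  rw [show 4 * Real.arcosh 2 = 2 * (2 * Real.arcosh 2) by ring, Real.cosh_two_mul, Real.sinh_sq,
    Real.cosh_two_mul, Real.sinh_sq, cosh_arcosh_two]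
  norm_num

lemma le_length {c : ℝ → Surface H17} {ℓ : ℝ} (h : IsClosedGeodesic H17 c ℓ) :
    4 * Real.arcosh 2 ≤ ℓ := by
  obtain ⟨hℓ, hper, γ, hγ, rfl⟩ := h
  obtain ⟨g, hg, e⟩ := proj_eq_iff.1 (hper 0).symm
  have hd : dist (γ 0) (γ (0 + ℓ)) = ℓ := by
    rw [hγ.dist_eq, Real.dist_eq]; simp [abs_of_pos hℓ]
  have hne : g ≠ 1 := by
    rintro rfl
    rw [one_smul] at e
    rw [← e, dist_self] at hd
    exact hℓ.ne hd
  have h1 := le_cosh_dist hg hne (γ 0)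
  rw [e, hd, ← cosh_four_mul_arcosh_two, Real.cosh_le_cosh, abs_of_pos hℓ] at h1
  exact (le_abs_self _).trans h1

theorem isLeast_length :
    IsLeast {ℓ | ∃ c, IsClosedGeodesic H17 c ℓ} (4 * Real.arcosh 2) := by
  refine ⟨?_, ?_⟩
  · obtain ⟨c, hc, -⟩ := isClosedGeodesic_curve 1 0
    exact ⟨c, hc⟩
  · rintro ℓ ⟨c, hc⟩
    exact le_length hc

lemma range_mem_curves {c : ℝ → Surface H17} (h : IsClosedGeodesic H17 c (4 * Real.arcosh 2)) :
    Set.range c ∈ curves H17 := by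
  obtain ⟨hℓ, hper, γ, hγ, rfl⟩ := h
  set L := 4 * Real.arcosh 2 with hL
  obtain ⟨g, hg, e⟩ := proj_eq_iff.1 (hper 0).symm
  rw [zero_add] at e
  have hd : dist (γ 0) (γ L) = L := by
    rw [hγ.dist_eq, Real.dist_eq]; simp [abs_of_pos hℓ]
  have hne : g ≠ 1 := by
    rintro rfl
    rw [one_smul] at e
    rw [← e, dist_self] at hd
    exact hℓ.ne hd
  obtain ⟨v, hv, hcosh⟩ := exists_cosh_dist_eq hg hne
  have key (z : ℍ) (hz : Real.cosh (dist z (g • z)) = 97) :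
      bil v v = 1 ∧ bil (toReal v) (coord z) = 0 := by
    rw [hcosh] at hz
    have hv' : (1 : ℝ) ≤ (bil v v : ℤ) := by exact_mod_cast hv
    have h2 := sq_nonneg (bil (toReal v) (coord z))
    have h3 : ((bil v v : ℤ) : ℝ) = 1 := by linarith
    exact ⟨by exact_mod_cast h3, pow_eq_zero_iff two_ne_zero |>.1 (by linarith)⟩
  obtain ⟨hv1, hv0⟩ := key (γ 0) (by rw [e, hd, cosh_four_mul_arcosh_two])
  -- `γ L` is the image of `γ 0` under `g`, so it has the same displacement. Both points lie on the
  -- line orthogonal to `v`, and so does all of `γ`.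
  have hvL := (key (γ L) (by
    rw [← e, dist_smul_smul (H17_le_W hg), e, hd, cosh_four_mul_arcosh_two])).2
  have hvt (t : ℝ) : bil (toReal v) (coord (γ t)) = 0 := by
    have h := congrArg (bil (toReal v)) (sinh_smul_coord hγ t L)
    rw [bil_add_right, bil_smul_right, bil_smul_right, bil_smul_right, hv0, hvL, mul_zero, mul_zero,
      add_zero] at h
    exact (mul_eq_zero.1 h).resolve_left (Real.sinh_pos_iff.2 hℓ).ne'
  -- Once moved to pass through the hexagon, a line orthogonal to a lattice vector of norm 1 carries
  -- a side.
  obtain ⟨w, hw, hwz⟩ := exists_smul_mem_hexagon (γ 0)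
  obtain ⟨T, hT, hT2, -⟩ := exists_represents w⁻¹ (inv_mem hw)
  have hTt (t : ℝ) : bil (toReal (T v)) (coord (w • γ t)) = 0 := by
    rw [← hT, inv_smul_smul, hvt]
  obtain ⟨k, hk⟩ := eq_root_of_bil_eq_zero (bil_root_nonpos hwz) (bil_center_coord_neg _)
    (v := T v) (by rw [hT2, hv1]) (hTt 0)
  have hline (t : ℝ) : w • γ t ∈ line k := by
    rw [mem_line_iff]
    have := hTt t
    rcases hk with hk | hk
    · rwa [hk] at this
    · rwa [hk, toReal_neg, bil_neg_left, neg_eq_zero] at this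
  have hr := range_eq_line ((isometry_smul hw).comp hγ) (k := k) hline
  refine ⟨w⁻¹, inv_mem hw, k, ?_⟩
  rw [Set.range_comp, ← hr]
  congr 1
  ext z
  rw [Set.mem_smul_set_iff_inv_smul_mem, inv_inv]
  simp

theorem systoles_eq_curves : systoles H17 = curves H17 := by
  ext C
  constructor
  · rintro ⟨c, ℓ, hc, hmin, rfl⟩
    obtain ⟨c', hc', -⟩ := isClosedGeodesic_curve 1 0
    rw [le_antisymm (hmin _ _ hc') (le_length hc)] at hc
    exact range_mem_curves hc
  · rintro ⟨w, hw, k, rfl⟩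
    obtain ⟨c, hc, hr⟩ := isClosedGeodesic_curve ⟨w, hw⟩ k
    exact ⟨c, _, hc, fun _ _ h => le_length h, hr.symm⟩

end Hexagon

end

open Hexagon in
theorem mainTheorem7 :
    Nonempty ((W ⧸ H) ≃* Multiplicative (ZMod 6 → ZMod 2)) ∧
    IsClosedSurfaceGroup H17 ∧
    IsTessellated H17 ∧ (tiles H17).ncard = 64 ∧ HasGenus H17 17 ∧
    systoles H17 = curves H17 ∧ (curves H17).ncard = 48 ∧
    IsLeast {ℓ | ∃ c, IsClosedGeodesic H17 c ℓ} (4 * Real.arcosh 2) :=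
  ⟨⟨quotientEquiv⟩, isClosedSurfaceGroup_H17, isTessellated_H17, tiles_finite_ncard.2, hasGenus_H17,
    systoles_eq_curves, curves_ncard, isLeast_length⟩
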